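/- Let $E$ be a complex Hilbert space of arbitrary dimension with open unit ball $B_E$. For an analytic map $g$ on $B_E$ with values in $\mathbb{C}$ or in $E$, let $g'(z)$ denote its Fréchet derivative and $\mathcal{R}g(z)=g'(z)(z)$ its radial derivative. The Bloch space $\mathcal{B}(B_E)$ is the space of all analytic functions $f:B_E\to\mathbb{C}$ with $\sup_{z\in B_E}(1-\|z\|^2)\|f'(z)\|<\infty$. It is endowed with the norm $\|f\|=|f(0)|+\sup_{a\in B_E}\|(f\circ\varphi_a)'(0)\|$. Here $\varphi_a:B_E\to B_E$ is the Möbius transform $$\varphi_a(x)=\bigl(\sqrt{1-\|a\|^2}\,(\mathrm{Id}-P_a)+P_a\bigr)\Bigl(\frac{a-x}{1-\langle x,a\rangle}\Bigr),$$ where $P_a$ is the orthogonal projection of $E$ onto $\mathbb{C}a$ and $\langle\cdot,\cdot\rangle$ is linear in the first variable. Let $\phi:B_E\to B_E$ be analytic. Assume that (i) for every $0<\delta<1$ the sets $\{\phi(z): z\in B_E,\ \|\phi(z)\|\le\delta\}$ and $\{(1-\|z\|^2)\mathcal{R}\phi(z): z\in B_E,\ \|\phi(z)\|\le\delta\}$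 are relatively compact in $E$; (ii) $\displaystyle\lim_{\|\phi(z)\|\to1}\frac{(1-\|z\|^2)\,\|\mathcal{R}\phi(z)\|}{\sqrt{1-\|\phi(z)\|^2}}=0$; (iii) $\displaystyle\lim_{\|\phi(z)\|\to1}\frac{(1-\|z\|^2)\,|\langle\phi(z),\mathcal{R}\phi(z)\rangle|}{1-\|\phi(z)\|^2}=0$. A limit as $\|\phi(z)\|\to1$ means that for every $\varepsilon>0$ there is $\delta<1$ such that the quantity is less than $\varepsilon$ for all $z\in B_E$ with $\|\phi(z)\|>\delta$. In particular, (ii) and (iii) hold vacuously when $\sup_{z\in B_E}\|\phi(z)\|<1$. Then $f\mapsto f\circ\phi$ maps $\mathcal{B}(B_E)$ into itself, and the composition operator $C_\phi:\mathcal{B}(B_E)\to\mathcal{B}(B_E)$, $C_\phi(f)=f\circ\phi$, is a compact (in particular bounded) linear operator. -/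

import Mathlib

open Metric Set Filter Topology

noncomputable section

namespace BlochBall

section Basic

set_option linter.unusedSectionVars false

variable {E : Type*} [NormedAddCommGroup E] [InnerProductSpace ℂ E]
variable {F : Type*} [NormedAddCommGroup F] [NormedSpace ℂ F]

/-- The extension by zero to `E` of a function on the open unit ball `B_E`. Only its values on the
(open) ball are ever used: it allows to speak of analyticity and derivatives of functions whose
domain is exactly `B_E`. -/
def zeroExt (f : ball (0 : E) 1 → F) : E → F := Function.extend Subtype.val f 0

/-- A function on the open unit ball is analytic: near each point of the ball it is the sum of a
convergent power series. -/
def IsAnalytic (f : ball (0 : E) 1 → F) : Prop := AnalyticOnNhd ℂ (zeroExt f) (ball (0 : E) 1)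

/-- The Fréchet derivative `f'(x) : E → F` of a function on the open unit ball. -/
def ballDeriv (f : ball (0 : E) 1 → F) (x : ball (0 : E) 1) : E →L[ℂ] F := fderiv ℂ (zeroExt f) x

/-- The radial derivative `R f(x) = f'(x)(x)`. -/
def radialDeriv (f : ball (0 : E) 1 → F) (x : ball (0 : E) 1) : F := ballDeriv f x x

/-- The orthogonal projection `P_a` onto the line spanned by `a` (zero when `a = 0`). -/
def projP (a : E) : E →L[ℂ] E := (Submodule.span ℂ {a}).starProjection

/-- The linear map `s_a Q_a + P_a`, where `s_a = √(1 - ‖a‖²)` and `Q_a = Id - P_a`. -/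
def moebiusLin (a : E) : E →L[ℂ] E :=
  ((√(1 - ‖a‖ ^ 2) : ℝ) : ℂ) • (ContinuousLinearMap.id ℂ E - projP a) + projP a

/-- The Möbius transform `φ_a(x) = (s_a Q_a + P_a) ((a - x) / (1 - ⟨x, a⟩))`. The scalar product
that is linear in `x` is `inner ℂ a x` in Mathlib. -/
def moebius (a x : E) : E := moebiusLin a ((1 - inner ℂ a x)⁻¹ • (a - x))

/-- The norm of the invariant gradient at `x`, i.e. the norm of the linear functional
`(f ∘ φ_x)'(0)`. -/
def invGradNorm (f : ball (0 : E) 1 → ℂ) (x : ball (0 : E) 1) : ℝ :=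
  ‖fderiv ℂ (fun y => zeroExt f (moebius (x : E) y)) 0‖

/-- Bloch functions: analytic functions on `B_E` with `sup (1 - ‖x‖²) ‖f'(x)‖ < ∞`. -/
def IsBloch (f : ball (0 : E) 1 → ℂ) : Prop :=
  IsAnalytic f ∧ BddAbove (range fun x : ball (0 : E) 1 => (1 - ‖(x : E)‖ ^ 2) * ‖ballDeriv f x‖)

/-! ### Elementary facts -/

theorem zeroExt_coe (f : ball (0 : E) 1 → F) (x : ball (0 : E) 1) : zeroExt f (x : E) = f x :=
  Subtype.val_injective.extend_apply f 0 x

theorem zeroExt_of_mem (f : ball (0 : E) 1 → F) {x : E} (hx : x ∈ ball (0 : E) 1) :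
    zeroExt f x = f ⟨x, hx⟩ := zeroExt_coe f ⟨x, hx⟩

theorem zeroExt_add (f g : ball (0 : E) 1 → F) : zeroExt (f + g) = zeroExt f + zeroExt g := by
  funext x
  by_cases hx : x ∈ ball (0 : E) 1
  · simp [zeroExt_of_mem _ hx]
  · have h : ¬ ∃ a : ball (0 : E) 1, (a : E) = x := by
      rintro ⟨a, rfl⟩; exact hx a.2
    simp [zeroExt, Function.extend_apply' _ _ _ h]

theorem zeroExt_smul (c : ℂ) (f : ball (0 : E) 1 → F) : zeroExt (c • f) = c • zeroExt f := by
  funext x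
  by_cases hx : x ∈ ball (0 : E) 1
  · simp [zeroExt_of_mem _ hx]
  · have h : ¬ ∃ a : ball (0 : E) 1, (a : E) = x := by
      rintro ⟨a, rfl⟩; exact hx a.2
    simp [zeroExt, Function.extend_apply' _ _ _ h]

theorem zeroExt_zero : zeroExt (0 : ball (0 : E) 1 → F) = 0 := by
  simpa using zeroExt_smul (0 : ℂ) (0 : ball (0 : E) 1 → F)

theorem one_sub_sq_pos (x : ball (0 : E) 1) : 0 < 1 - ‖(x : E)‖ ^ 2 := by
  have h := x.2
  rw [mem_ball_zero_iff] at h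
  nlinarith [norm_nonneg (x : E)]

theorem IsAnalytic.differentiableAt {f : ball (0 : E) 1 → F} (hf : IsAnalytic f)
    (x : ball (0 : E) 1) : DifferentiableAt ℂ (zeroExt f) (x : E) := (hf x x.2).differentiableAt

theorem ballDeriv_add {f g : ball (0 : E) 1 → F} (hf : IsAnalytic f) (hg : IsAnalytic g)
    (x : ball (0 : E) 1) : ballDeriv (f + g) x = ballDeriv f x + ballDeriv g x := by
  rw [ballDeriv, zeroExt_add, fderiv_add (hf.differentiableAt x) (hg.differentiableAt x)]; rfl

theorem ballDeriv_smul (c : ℂ) {f : ball (0 : E) 1 → F} (hf : IsAnalytic f)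
    (x : ball (0 : E) 1) : ballDeriv (c • f) x = c • ballDeriv f x := by
  rw [ballDeriv, zeroExt_smul, fderiv_const_smul (hf.differentiableAt x)]; rfl

/-! ### The derivative of `f ∘ φ_x` at the origin -/

theorem projP_self (a : E) : projP a a = a :=
  Submodule.starProjection_eq_self_iff.2 (Submodule.mem_span_singleton_self a)

theorem projP_proj (a w : E) : projP a (projP a w) = projP a w :=
  Submodule.starProjection_eq_self_iff.2 (Submodule.starProjection_apply_mem _ w)

theorem norm_projP_le (a w : E) : ‖projP a w‖ ≤ ‖w‖ :=
  Submodule.norm_starProjection_apply_le _ w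

theorem inner_sub_projP (a w : E) : inner ℂ a (w - projP a w) = 0 :=
  inner_eq_zero_symm.1
    (Submodule.starProjection_inner_eq_zero w a (Submodule.mem_span_singleton_self a))

theorem inner_smul_eq (a w : E) : inner ℂ a w • a = ((‖a‖ ^ 2 : ℝ) : ℂ) • projP a w := by
  have := Submodule.smul_starProjection_singleton ℂ (v := a) w
  simpa [projP] using this.symm

theorem moebius_zero (a : E) : moebius a 0 = a := by
  simp [moebius, moebiusLin, projP_self]

theorem moebiusLin_apply (a w : E) :
    moebiusLin a w = ((√(1 - ‖a‖ ^ 2) : ℝ) : ℂ) • (w - projP a w) + projP a w := rfl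

/-- `φ_a'(0) = - s_a² P_a - s_a Q_a`. -/
def moebiusDeriv (a : E) : E →L[ℂ] E :=
  -(((1 - ‖a‖ ^ 2 : ℝ) : ℂ) • projP a +
    ((√(1 - ‖a‖ ^ 2) : ℝ) : ℂ) • (ContinuousLinearMap.id ℂ E - projP a))

theorem moebiusDeriv_apply (a w : E) :
    moebiusDeriv a w = -(((1 - ‖a‖ ^ 2 : ℝ) : ℂ) • projP a w +
      ((√(1 - ‖a‖ ^ 2) : ℝ) : ℂ) • (w - projP a w)) := rfl

theorem hasFDerivAt_moebius (a : E) : HasFDerivAt (moebius a) (moebiusDeriv a) 0 := by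
  have h1 : HasFDerivAt (fun y : E => (1 : ℂ) - inner ℂ a y) (-(innerSL ℂ a)) 0 :=
    (innerSL ℂ a).hasFDerivAt.const_sub 1
  have h2 : HasFDerivAt (fun y : E => ((1 : ℂ) - inner ℂ a y)⁻¹) (innerSL ℂ a) 0 := by
    have h := (hasDerivAt_inv (x := (1 : ℂ) - inner ℂ a (0 : E)) (by simp)).comp_hasFDerivAt 0 h1
    exact h.congr_fderiv (by ext w; simp)
  have h3 : HasFDerivAt (fun y : E => a - y) (-(ContinuousLinearMap.id ℂ E)) 0 :=
    (hasFDerivAt_id (0 : E)).const_sub a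
  have h4 := (moebiusLin a).hasFDerivAt.comp (0 : E) (h2.smul h3)
  refine h4.congr_fderiv ?_
  ext w
  have hP : projP a (inner ℂ a w • a) = inner ℂ a w • a := by rw [map_smul, projP_self]
  simp only [ContinuousLinearMap.comp_apply, moebiusDeriv_apply, moebiusLin_apply]
  simp only [add_apply, ContinuousLinearMap.smulRight_apply, neg_apply, innerSL_apply_apply,
    ContinuousLinearMap.id_apply, inner_zero_right, sub_zero, inv_one, one_smul, map_add, map_neg,
    hP]
  rw [inner_smul_eq]
  push_cast
  module

theorem fderiv_comp_moebius {f : ball (0 : E) 1 → ℂ} (hf : IsAnalytic f) (x : ball (0 : E) 1) :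
    fderiv ℂ (fun y => zeroExt f (moebius (x : E) y)) 0 =
      (ballDeriv f x).comp (moebiusDeriv (x : E)) := by
  have h1 : HasFDerivAt (zeroExt f) (ballDeriv f x) (moebius (x : E) 0) := by
    rw [moebius_zero]; exact (hf.differentiableAt x).hasFDerivAt
  exact (h1.comp (0 : E) (hasFDerivAt_moebius (x : E))).fderiv

/-! ### Boundedness of the invariant gradient of a Bloch function -/

theorem hasFDerivAt_fderiv_apply {g : E → ℂ} (hg : AnalyticOnNhd ℂ g (ball (0 : E) 1))
    {y : E} (hy : y ∈ ball (0 : E) 1) (x : E) :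
    HasFDerivAt (fun y => fderiv ℂ g y x) ((fderiv ℂ (fderiv ℂ g) y).flip x) y := by
  have h1 : HasFDerivAt (fderiv ℂ g) (fderiv ℂ (fderiv ℂ g) y) y :=
    (hg.fderiv y hy).differentiableAt.hasFDerivAt
  exact (ContinuousLinearMap.apply ℂ ℂ x).hasFDerivAt.comp y h1

/-- Cauchy estimate for the derivative in direction `v ⟂ x`. -/
theorem second_deriv_bound {g : E → ℂ} (hg : AnalyticOnNhd ℂ g (ball (0 : E) 1)) {M : ℝ}
    (hM : ∀ y ∈ ball (0 : E) 1, (1 - ‖y‖ ^ 2) * ‖fderiv ℂ g y‖ ≤ M)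
    {y x v : E} (hy : y ∈ ball (0 : E) 1) (hx : ‖x‖ ≤ 1) (hv : ‖v‖ = 1) (hyv : inner ℂ y v = 0) :
    ‖fderiv ℂ (fderiv ℂ g) y x v‖ ≤ 3 * M / ((1 - ‖y‖ ^ 2) * √(1 - ‖y‖ ^ 2)) := by
  set u : ℝ := 1 - ‖y‖ ^ 2 with hu
  have hu0 : 0 < u := one_sub_sq_pos ⟨y, hy⟩
  have hM0 : 0 ≤ M := le_trans (mul_nonneg hu0.le (norm_nonneg _)) (hM y hy)
  have hs0 : 0 < √u := Real.sqrt_pos.2 hu0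
  have hss : √u ^ 2 = u := Real.sq_sqrt hu0.le
  set ρ : ℝ := 2 / 3 * √u with hρ
  have hρ0 : 0 < ρ := by positivity
  have hnorm : ∀ c : ℂ, ‖y + c • v‖ ^ 2 = ‖y‖ ^ 2 + ‖c‖ ^ 2 := by
    intro c
    have := norm_add_sq_eq_norm_sq_add_norm_sq_of_inner_eq_zero (𝕜 := ℂ) y (c • v)
      (by rw [inner_smul_right, hyv, mul_zero])
    rw [norm_smul, hv, mul_one] at this
    nlinarith [this]
  have hball : ∀ c : ℂ, ‖c‖ ≤ ρ → 5 / 9 * u ≤ 1 - ‖y + c • v‖ ^ 2 := by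
    intro c hc
    have : ‖c‖ ^ 2 ≤ ρ ^ 2 := by gcongr
    rw [hnorm]
    have h2 : ρ ^ 2 = 4 / 9 * u := by rw [hρ, mul_pow, hss]; norm_num
    linarith
  have hmem : ∀ c : ℂ, ‖c‖ ≤ ρ → y + c • v ∈ ball (0 : E) 1 := by
    intro c hc
    rw [mem_ball_zero_iff]
    have := hball c hc
    nlinarith [norm_nonneg (y + c • v)]
  have hder : ∀ c : ℂ, ‖c‖ ≤ ρ →
      HasDerivAt (fun c : ℂ => fderiv ℂ g (y + c • v) x)
        (fderiv ℂ (fderiv ℂ g) (y + c • v) v x) c := by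
    intro c hc
    have h2 : HasDerivAt (fun c : ℂ => y + c • v) v c := by
      simpa using ((hasDerivAt_id c).smul_const v).const_add y
    exact (hasFDerivAt_fderiv_apply hg (hmem c hc) x).comp_hasDerivAt c h2
  have hdc : DiffContOnCl ℂ (fun c : ℂ => fderiv ℂ g (y + c • v) x) (ball 0 ρ) := by
    refine DifferentiableOn.diffContOnCl ?_
    intro c hc
    have hc' := closure_ball_subset_closedBall hc
    exact (hder c (by simpa using hc')).differentiableAt.differentiableWithinAt
  have hC : ∀ c ∈ sphere (0 : ℂ) ρ, ‖fderiv ℂ g (y + c • v) x‖ ≤ 9 / 5 * (M / u) := by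
    intro c hc
    have hc' : ‖c‖ ≤ ρ := by simpa using (mem_sphere.1 hc).le
    have h1 := hM _ (hmem c hc')
    have h2 := hball c hc'
    have h3 : 5 / 9 * u * ‖fderiv ℂ g (y + c • v)‖ ≤ M :=
      le_trans (mul_le_mul_of_nonneg_right h2 (norm_nonneg _)) h1
    calc ‖fderiv ℂ g (y + c • v) x‖ ≤ ‖fderiv ℂ g (y + c • v)‖ * ‖x‖ :=
          ContinuousLinearMap.le_opNorm _ _
      _ ≤ ‖fderiv ℂ g (y + c • v)‖ := mul_le_of_le_one_right (norm_nonneg _) hx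
      _ ≤ 9 / 5 * (M / u) := by
          rw [mul_div_assoc', le_div_iff₀ hu0]; linarith
  have hcauchy := Complex.norm_deriv_le_of_forall_mem_sphere_norm_le hρ0 hdc hC
  rw [(hder 0 (by simpa using hρ0.le)).deriv, zero_smul, add_zero] at hcauchy
  have hsym : fderiv ℂ (fderiv ℂ g) y x v = fderiv ℂ (fderiv ℂ g) y v x :=
    (hg y hy).contDiffAt.isSymmSndFDerivAt (n := 2) (by simp) x v
  rw [hsym]
  refine hcauchy.trans ?_
  rw [hρ, div_le_div_iff₀ (by positivity) (by positivity)]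
  have : 9 / 5 * (M / u) * (u * √u) = 9 / 5 * M * √u := by field_simp
  rw [this]
  nlinarith [mul_nonneg hM0 hs0.le]

theorem transverse_bound_unit {g : E → ℂ} (hg : AnalyticOnNhd ℂ g (ball (0 : E) 1)) {M : ℝ}
    (hM : ∀ y ∈ ball (0 : E) 1, (1 - ‖y‖ ^ 2) * ‖fderiv ℂ g y‖ ≤ M)
    {x v : E} (hx : x ∈ ball (0 : E) 1) (hv : ‖v‖ = 1) (hxv : inner ℂ x v = 0) :
    √(1 - ‖x‖ ^ 2) * ‖fderiv ℂ g x v‖ ≤ 4 * M := by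
  have hx1 : ‖x‖ < 1 := mem_ball_zero_iff.1 hx
  have hM0 : 0 ≤ M :=
    le_trans (mul_nonneg (one_sub_sq_pos ⟨x, hx⟩).le (norm_nonneg _)) (hM x hx)
  have hnorm : ∀ t ∈ Icc (0 : ℝ) 1, ‖(t : ℂ) • x‖ = t * ‖x‖ := by
    intro t ht
    rw [norm_smul, Complex.norm_real, Real.norm_of_nonneg ht.1]
  have hmem : ∀ t ∈ Icc (0 : ℝ) 1, (t : ℂ) • x ∈ ball (0 : E) 1 := by
    intro t ht
    rw [mem_ball_zero_iff, hnorm t ht]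
    nlinarith [ht.1, ht.2, norm_nonneg x]
  have hpos : ∀ t ∈ Icc (0 : ℝ) 1, 0 < 1 - (t * ‖x‖) ^ 2 := by
    intro t ht
    have := one_sub_sq_pos ⟨_, hmem t ht⟩
    rwa [hnorm t ht] at this
  have hder : ∀ t ∈ Icc (0 : ℝ) 1, HasDerivAt (fun t : ℝ => fderiv ℂ g ((t : ℂ) • x) v)
      (fderiv ℂ (fderiv ℂ g) ((t : ℂ) • x) x v) t := by
    intro t ht
    have h2 : HasDerivAt (fun c : ℂ => c • x) x (t : ℂ) := by
      simpa using (hasDerivAt_id (t : ℂ)).smul_const x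
    exact ((hasFDerivAt_fderiv_apply hg (hmem t ht) v).comp_hasDerivAt (t : ℂ) h2).comp_ofReal
  have hB : ∀ t ∈ Icc (0 : ℝ) 1,
      HasDerivAt (fun t : ℝ => M + 3 * M * (t / √(1 - (t * ‖x‖) ^ 2)))
        (3 * M / ((1 - (t * ‖x‖) ^ 2) * √(1 - (t * ‖x‖) ^ 2))) t := by
    intro t ht
    have hp := hpos t ht
    have hs0 : 0 < √(1 - (t * ‖x‖) ^ 2) := Real.sqrt_pos.2 hp
    have hss : √(1 - (t * ‖x‖) ^ 2) ^ 2 = 1 - (t * ‖x‖) ^ 2 := Real.sq_sqrt hp.le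
    have h1 : HasDerivAt (fun t : ℝ => 1 - (t * ‖x‖) ^ 2) (-(2 * (t * ‖x‖) * ‖x‖)) t := by
      simpa using (((hasDerivAt_id t).mul_const ‖x‖).pow 2).const_sub 1
    have h2 := (((hasDerivAt_id t).div (h1.sqrt hp.ne') hs0.ne').const_mul (3 * M)).const_add M
    refine h2.congr_deriv ?_
    simp only [id]
    set s := √(1 - (t * ‖x‖) ^ 2) with hs
    rw [← hss]
    field_simp
    linear_combination M * hss
  have key := image_norm_le_of_norm_deriv_right_le_deriv_boundary'
    (f := fun t : ℝ => fderiv ℂ g ((t : ℂ) • x) v) (a := 0) (b := 1)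
    (fun t ht => (hder t ht).continuousAt.continuousWithinAt)
    (fun t ht => (hder t (Ico_subset_Icc_self ht)).hasDerivWithinAt)
    (B := fun t : ℝ => M + 3 * M * (t / √(1 - (t * ‖x‖) ^ 2)))
    (by
      have h0 := hM 0 (by simp)
      have h1 := (fderiv ℂ g 0).le_opNorm v
      rw [hv, mul_one] at h1
      simp at h0 ⊢
      exact h1.trans h0)
    (fun t ht => (hB t ht).continuousAt.continuousWithinAt)
    (fun t ht => (hB t (Ico_subset_Icc_self ht)).hasDerivWithinAt)
    (fun t ht => by
      have ht' := Ico_subset_Icc_self ht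
      have := second_deriv_bound hg hM (hmem t ht') hx1.le hv
        (by rw [inner_smul_left, hxv, mul_zero])
      rwa [hnorm t ht'] at this)
    (right_mem_Icc.2 zero_le_one)
  simp only [Complex.ofReal_one, one_smul, one_mul] at key
  have hp := one_sub_sq_pos ⟨x, hx⟩
  have hs0 : 0 < √(1 - ‖x‖ ^ 2) := Real.sqrt_pos.2 hp
  have hs1 : √(1 - ‖x‖ ^ 2) ≤ 1 := Real.sqrt_le_one.2 (by nlinarith [norm_nonneg x])
  calc √(1 - ‖x‖ ^ 2) * ‖fderiv ℂ g x v‖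
      ≤ √(1 - ‖x‖ ^ 2) * (M + 3 * M * (1 / √(1 - ‖x‖ ^ 2))) := by gcongr
    _ = √(1 - ‖x‖ ^ 2) * M + 3 * M := by field_simp
    _ ≤ 4 * M := by nlinarith

theorem transverse_bound {g : E → ℂ} (hg : AnalyticOnNhd ℂ g (ball (0 : E) 1)) {M : ℝ}
    (hM : ∀ y ∈ ball (0 : E) 1, (1 - ‖y‖ ^ 2) * ‖fderiv ℂ g y‖ ≤ M)
    {x v : E} (hx : x ∈ ball (0 : E) 1) (hxv : inner ℂ x v = 0) :
    √(1 - ‖x‖ ^ 2) * ‖fderiv ℂ g x v‖ ≤ 4 * M * ‖v‖ := by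
  rcases eq_or_ne v 0 with rfl | hv
  · simp
  have hv0 : 0 < ‖v‖ := norm_pos_iff.2 hv
  have h := transverse_bound_unit hg hM hx (v := ((‖v‖⁻¹ : ℝ) : ℂ) • v)
    (by rw [norm_smul, Complex.norm_real, norm_inv, norm_norm, inv_mul_cancel₀ hv0.ne'])
    (by rw [inner_smul_right, hxv, mul_zero])
  rw [map_smul, norm_smul, Complex.norm_real, norm_inv, norm_norm] at h
  calc √(1 - ‖x‖ ^ 2) * ‖fderiv ℂ g x v‖
      = √(1 - ‖x‖ ^ 2) * (‖v‖⁻¹ * ‖fderiv ℂ g x v‖) * ‖v‖ := by field_simp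
    _ ≤ 4 * M * ‖v‖ := by gcongr

theorem invGradNorm_le {f : ball (0 : E) 1 → ℂ} (hf : IsAnalytic f) {M : ℝ}
    (hM : ∀ y : ball (0 : E) 1, (1 - ‖(y : E)‖ ^ 2) * ‖ballDeriv f y‖ ≤ M) (x : ball (0 : E) 1) :
    invGradNorm f x ≤ 9 * M := by
  have hp := one_sub_sq_pos x
  have hM0 : 0 ≤ M := le_trans (mul_nonneg hp.le (norm_nonneg _)) (hM x)
  rw [invGradNorm, fderiv_comp_moebius hf]
  refine ContinuousLinearMap.opNorm_le_bound _ (by positivity) fun w => ?_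
  have h1 : (1 - ‖(x : E)‖ ^ 2) * ‖ballDeriv f x (projP (x : E) w)‖ ≤ M * ‖w‖ :=
    calc _ ≤ (1 - ‖(x : E)‖ ^ 2) * (‖ballDeriv f x‖ * ‖w‖) := by
          gcongr
          exact (ContinuousLinearMap.le_opNorm _ _).trans
            (mul_le_mul_of_nonneg_left (norm_projP_le _ _) (norm_nonneg _))
      _ = (1 - ‖(x : E)‖ ^ 2) * ‖ballDeriv f x‖ * ‖w‖ := by ring
      _ ≤ M * ‖w‖ := by gcongr; exact hM x
  have h2 : √(1 - ‖(x : E)‖ ^ 2) * ‖ballDeriv f x (w - projP (x : E) w)‖ ≤ 8 * M * ‖w‖ := by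
    have h := transverse_bound hf (fun y hy => hM ⟨y, hy⟩) x.2 (inner_sub_projP (x : E) w)
    have h3 : ‖w - projP (x : E) w‖ ≤ 2 * ‖w‖ := by
      linarith [norm_sub_le w (projP (x : E) w), norm_projP_le (x : E) w]
    refine h.trans ?_
    nlinarith
  rw [ContinuousLinearMap.comp_apply, moebiusDeriv_apply, map_neg, norm_neg, map_add, map_smul,
    map_smul]
  refine (norm_add_le _ _).trans ?_
  rw [norm_smul, norm_smul, Complex.norm_real, Complex.norm_real, Real.norm_of_nonneg hp.le,
    Real.norm_of_nonneg (Real.sqrt_nonneg _)]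
  linarith

theorem IsBloch.bddAbove_invGradNorm {f : ball (0 : E) 1 → ℂ} (hf : IsBloch f) :
    BddAbove (range (invGradNorm f)) := by
  obtain ⟨M, hM⟩ := hf.2
  exact ⟨9 * M, by
    rintro _ ⟨x, rfl⟩
    exact invGradNorm_le hf.1 (fun y => hM (mem_range_self y)) x⟩

theorem invGradNorm_add {f g : ball (0 : E) 1 → ℂ} (hf : IsAnalytic f) (hg : IsAnalytic g)
    (hfg : IsAnalytic (f + g)) (x : ball (0 : E) 1) :
    invGradNorm (f + g) x ≤ invGradNorm f x + invGradNorm g x := by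
  simp only [invGradNorm]
  rw [fderiv_comp_moebius hf, fderiv_comp_moebius hg, fderiv_comp_moebius hfg, ballDeriv_add hf hg,
    ContinuousLinearMap.add_comp]
  exact norm_add_le _ _

theorem invGradNorm_smul (c : ℂ) {f : ball (0 : E) 1 → ℂ} (hf : IsAnalytic f)
    (hcf : IsAnalytic (c • f)) (x : ball (0 : E) 1) :
    invGradNorm (c • f) x = ‖c‖ * invGradNorm f x := by
  simp only [invGradNorm]
  rw [fderiv_comp_moebius hf, fderiv_comp_moebius hcf, ballDeriv_smul c hf,
    ContinuousLinearMap.smul_comp, norm_smul]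

theorem ballDeriv_eq_zero {f : ball (0 : E) 1 → ℂ} (hf : IsAnalytic f) {x : ball (0 : E) 1}
    (h : invGradNorm f x = 0) : ballDeriv f x = 0 := by
  rw [invGradNorm, norm_eq_zero, fderiv_comp_moebius hf] at h
  have hp := one_sub_sq_pos x
  have hss : ((√(1 - ‖(x : E)‖ ^ 2) : ℝ) : ℂ) ^ 2 = ((1 - ‖(x : E)‖ ^ 2 : ℝ) : ℂ) := by
    rw [← Complex.ofReal_pow, Real.sq_sqrt hp.le]
  set P := projP (x : E) with hP
  have hc : ((1 - ‖(x : E)‖ ^ 2 : ℝ) : ℂ) ≠ 0 := by exact_mod_cast hp.ne'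
  ext w
  have hw := DFunLike.congr_fun h (P w + ((√(1 - ‖(x : E)‖ ^ 2) : ℝ) : ℂ) • (w - P w))
  have hD : moebiusDeriv (x : E) (P w + ((√(1 - ‖(x : E)‖ ^ 2) : ℝ) : ℂ) • (w - P w)) =
      -(((1 - ‖(x : E)‖ ^ 2 : ℝ) : ℂ) • w) := by
    rw [moebiusDeriv_apply, ← hP]
    have hPP : P (P w) = P w := projP_proj _ w
    simp only [map_add, map_smul, map_sub, hPP, sub_self, smul_zero, add_zero]
    rw [← hss]
    module
  rw [ContinuousLinearMap.comp_apply, hD, map_neg, map_smul] at hw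
  rw [zero_apply, neg_eq_zero] at hw
  exact (smul_eq_zero.1 hw).resolve_left hc

end Basic

/-! ### The Bloch space -/

section Space

variable (E : Type*) [NormedAddCommGroup E] [InnerProductSpace ℂ E]

/-- The vector space of Bloch functions on `B_E`, as a subspace of all functions `B_E → ℂ`. -/
def blochSubmodule : Submodule ℂ (ball (0 : E) 1 → ℂ) where
  carrier := {f | IsBloch f}
  add_mem' := by
    rintro f g ⟨hf, Mf, hMf⟩ ⟨hg, Mg, hMg⟩
    refine ⟨?_, Mf + Mg, ?_⟩
    · rw [IsAnalytic, zeroExt_add]; exact hf.add hg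
    · rintro _ ⟨x, rfl⟩
      have h1 := hMf (mem_range_self x)
      have h2 := hMg (mem_range_self x)
      have hp := one_sub_sq_pos x
      simp only [ballDeriv_add hf hg] at *
      nlinarith [norm_add_le (ballDeriv f x) (ballDeriv g x)]
  zero_mem' := by
    have h0 : IsAnalytic (0 : ball (0 : E) 1 → ℂ) := by
      rw [IsAnalytic, zeroExt_zero]; exact analyticOnNhd_const
    refine ⟨h0, 0, ?_⟩
    rintro _ ⟨x, rfl⟩
    simp [ballDeriv, zeroExt_zero]
  smul_mem' := by
    rintro c f ⟨hf, M, hM⟩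
    refine ⟨?_, ‖c‖ * M, ?_⟩
    · rw [IsAnalytic, zeroExt_smul]; exact fun x hx => (hf x hx).const_smul
    · rintro _ ⟨x, rfl⟩
      have h1 := hM (mem_range_self x)
      simp only [ballDeriv_smul c hf, norm_smul] at *
      nlinarith [mul_le_mul_of_nonneg_left h1 (norm_nonneg c)]

/-- The Bloch space `𝓑(B_E)`; it carries the Bloch norm (and not the topology of pointwise
convergence). -/
def Bloch : Type _ := ↥(blochSubmodule E)

instance : AddCommGroup (Bloch E) := inferInstanceAs (AddCommGroup ↥(blochSubmodule E))

instance : Module ℂ (Bloch E) := inferInstanceAs (Module ℂ ↥(blochSubmodule E))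

instance : CoeFun (Bloch E) (fun _ => ball (0 : E) 1 → ℂ) := ⟨Subtype.val⟩

variable {E}

theorem Bloch.isBloch (f : Bloch E) : IsBloch (f : ball (0 : E) 1 → ℂ) := f.2

/-- The centre of the ball. -/
def ballZero : ball (0 : E) 1 := ⟨0, mem_ball_self one_pos⟩

/-- The invariant semi-norm: the supremum over the ball of the norm of the invariant gradient. -/
def Bloch.invSeminorm (f : Bloch E) : ℝ := ⨆ x : ball (0 : E) 1, invGradNorm f x

/-- The Bloch norm `|f(0)| + ‖f‖_inv`. -/
instance : Norm (Bloch E) := ⟨fun f => ‖f ballZero‖ + f.invSeminorm⟩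

theorem Bloch.norm_def (f : Bloch E) : ‖f‖ = ‖f ballZero‖ + ⨆ x, invGradNorm f x := rfl

theorem Bloch.coe_add (f g : Bloch E) : ⇑(f + g) = f + g := rfl

theorem Bloch.coe_smul (c : ℂ) (f : Bloch E) : ⇑(c • f) = c • ⇑f := rfl

theorem Bloch.normedSpaceCore : NormedSpace.Core ℂ (Bloch E) := by
  have hne : Nonempty (ball (0 : E) 1) := ⟨ballZero⟩
  have hnn : ∀ (f : Bloch E) x, 0 ≤ invGradNorm f x := fun f x => norm_nonneg _
  refine { norm_nonneg := ?_, norm_smul := ?_, norm_triangle := ?_, norm_eq_zero_iff := ?_ }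
  · intro f
    exact add_nonneg (norm_nonneg _) (Real.iSup_nonneg (hnn f))
  · intro c f
    rw [norm_def, norm_def, mul_add, Real.mul_iSup_of_nonneg (norm_nonneg c)]
    congr 1
    · rw [coe_smul, Pi.smul_apply, norm_smul]
    · exact iSup_congr fun x => invGradNorm_smul c f.isBloch.1 (c • f).isBloch.1 x
  · intro f g
    rw [norm_def, norm_def, norm_def]
    have h1 : ‖(f + g) ballZero‖ ≤ ‖f ballZero‖ + ‖g ballZero‖ := norm_add_le _ _
    have h2 : ⨆ x, invGradNorm (f + g : Bloch E) x ≤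
        (⨆ x, invGradNorm f x) + ⨆ x, invGradNorm g x :=
      ciSup_le fun x => (invGradNorm_add f.isBloch.1 g.isBloch.1 (f + g).isBloch.1 x).trans
        (add_le_add (le_ciSup f.isBloch.bddAbove_invGradNorm x)
          (le_ciSup g.isBloch.bddAbove_invGradNorm x))
    linarith
  · intro f
    constructor
    · intro h
      have hs : 0 ≤ ⨆ x, invGradNorm f x := Real.iSup_nonneg (hnn f)
      rw [norm_def] at h
      have h0 : ‖f ballZero‖ = 0 := by linarith [norm_nonneg (f ballZero)]
      have h1 : ⨆ x, invGradNorm f x = 0 := by linarith [norm_nonneg (f ballZero)]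
      have hd : ∀ x : ball (0 : E) 1, ballDeriv f x = 0 := fun x =>
        ballDeriv_eq_zero f.isBloch.1
          (le_antisymm ((le_ciSup f.isBloch.bddAbove_invGradNorm x).trans h1.le) (hnn f x))
      have hconst : ∀ x : ball (0 : E) 1, f x = f ballZero := by
        intro x
        have := isOpen_ball.is_const_of_fderiv_eq_zero (𝕜 := ℂ)
          (convex_ball (0 : E) 1).isPreconnected f.isBloch.1.differentiableOn
          (fun y hy => hd ⟨y, hy⟩) x.2 (ballZero (E := E)).2
        rwa [zeroExt_coe, zeroExt_coe] at this
      apply Subtype.ext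
      funext x
      exact (hconst x).trans (norm_eq_zero.1 h0)
    · rintro rfl
      have h : ∀ x, invGradNorm ((0 : Bloch E) : ball (0 : E) 1 → ℂ) x = 0 := by
        intro x
        have : ((0 : Bloch E) : ball (0 : E) 1 → ℂ) = 0 := rfl
        simp [invGradNorm, this, zeroExt_zero]
      rw [norm_def]
      simp only [h, ciSup_const, add_zero, norm_eq_zero]
      rfl

instance : NormedAddCommGroup (Bloch E) := NormedAddCommGroup.ofCore Bloch.normedSpaceCore

instance : NormedSpace ℂ (Bloch E) := NormedSpace.ofCore Bloch.normedSpaceCore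

end Space

end BlochBall

end

/-! Write `w(z) = (1 - ‖z‖²) Rφ(z)`. By the chain rule the weighted radial derivative of `f ∘ φ` at
`z` is `f'(φ(z))(w(z))`. The Bloch norm of a function is bounded by its value at the origin plus a
constant times the supremum of its weighted radial derivative (`invGradNorm_le_of_radial`), so
everything reduces to the functionals `f ↦ f'(φ(z))(w(z))`.

Where `φ(z)` is close to the sphere, split `w(z)` into its components along and orthogonal to
`φ(z)`. The invariant gradient charges them with the weights `1/(1 - ‖φ(z)‖²)` and `1/√(1 -
‖φ(z)‖²)`; hypotheses (iii) and (ii) say that the resulting quantities tend to zero, so the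
functional is at most `η‖f‖` (`exists_norm_apply_weightedRadial_le`). Where `‖φ(z)‖ ≤ δ`, hypothesis
(i) makes the pairs `(φ(z), w(z))` totally bounded, and derivatives of Bloch functions are bounded
and Lipschitz there with constants proportional to `‖f‖`. Hence finitely many sample points control
all the functionals up to `η‖f‖` (`exists_finite_approx`).

Boundedness of the operator follows from the same two regimes. For compactness, finitely many
scalars attached to `f` determine `f ∘ φ` up to `ε` on the unit ball, so its image is totally
bounded (`totallyBounded_image_of_approx`). The closure of this image is compact because the Bloch
space is complete, which rests on a Weierstrass theorem for uniform limits of analytic maps in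
arbitrary dimension (`analyticAt_of_tendstoUniformlyOn`). -/

namespace BlochBall

/-! ### Cauchy estimates, Taylor series and uniform limits of analytic maps -/

section Analytic

variable {E G : Type*} [NormedAddCommGroup E] [NormedSpace ℂ E] [NormedAddCommGroup G]
  [NormedSpace ℂ G]

/-- Cauchy estimate for a directional derivative. -/
theorem norm_fderiv_apply_le {f : E → G} {x v : E} {s M : ℝ} (hs : 0 < s)
    (hd : ∀ c : ℂ, ‖c‖ ≤ s → DifferentiableAt ℂ f (x + c • v))
    (hM : ∀ c : ℂ, ‖c‖ ≤ s → ‖f (x + c • v)‖ ≤ M) : ‖fderiv ℂ f x v‖ ≤ M / s := by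
  have hder : ∀ c : ℂ, ‖c‖ ≤ s →
      HasDerivAt (fun c : ℂ => f (x + c • v)) (fderiv ℂ f (x + c • v) v) c := by
    intro c hc
    have h2 : HasDerivAt (fun c : ℂ => x + c • v) v c := by
      simpa using ((hasDerivAt_id c).smul_const v).const_add x
    exact (hd c hc).hasFDerivAt.comp_hasDerivAt c h2
  have hdc : DiffContOnCl ℂ (fun c : ℂ => f (x + c • v)) (ball 0 s) := by
    refine DifferentiableOn.diffContOnCl fun c hc => ?_
    have hc' := closure_ball_subset_closedBall hc
    exact (hder c (by simpa using hc')).differentiableAt.differentiableWithinAt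
  have h := Complex.norm_deriv_le_of_forall_mem_sphere_norm_le hs hdc
    (fun c hc => hM c (by simpa using (mem_sphere.1 hc).le))
  rwa [(hder 0 (by simpa using hs.le)).deriv, zero_smul, add_zero] at h

/-- Cauchy estimate for the Fréchet derivative. -/
theorem norm_fderiv_le {f : E → G} {x : E} {s M : ℝ} (hs : 0 < s)
    (hd : ∀ y ∈ closedBall x s, DifferentiableAt ℂ f y)
    (hM : ∀ y ∈ closedBall x s, ‖f y‖ ≤ M) : ‖fderiv ℂ f x‖ ≤ M / s := by
  have hM0 : 0 ≤ M := (norm_nonneg _).trans (hM x (mem_closedBall_self hs.le))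
  refine ContinuousLinearMap.opNorm_le_bound _ (by positivity) fun v => ?_
  rcases eq_or_ne v 0 with rfl | hv
  · simp
  have hv0 : 0 < ‖v‖ := norm_pos_iff.2 hv
  have hmem : ∀ c : ℂ, ‖c‖ ≤ s / ‖v‖ → x + c • v ∈ closedBall x s := by
    intro c hc
    rw [mem_closedBall, dist_self_add_left, norm_smul]
    rwa [le_div_iff₀ hv0] at hc
  have h := norm_fderiv_apply_le (div_pos hs hv0) (fun c hc => hd _ (hmem c hc))
    (fun c hc => hM _ (hmem c hc))
  rwa [div_div_eq_mul_div, mul_div_right_comm] at h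

/-- Each differentiation is one Cauchy estimate on a ball of radius `h`, so `k` of them consume a
distance `k * h` to the boundary. -/
theorem norm_iteratedFDeriv_le {f : E → G} {x : E} {r M h : ℝ} (hh : 0 < h)
    (hf : AnalyticOnNhd ℂ f (ball x r)) (hM : ∀ y ∈ ball x r, ‖f y‖ ≤ M) (k : ℕ) :
    ∀ y : E, dist y x + k * h < r → ‖iteratedFDeriv ℂ k f y‖ ≤ M / h ^ k := by
  induction k with
  | zero =>
    intro y hy
    simpa using hM y (by simpa using hy)
  | succ k ih =>
    intro y hy
    push_cast at hy
    have hsub : ∀ z ∈ closedBall y h, dist z x + k * h < r := by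
      intro z hz
      have := dist_triangle z y x
      rw [mem_closedBall] at hz
      linarith
    have hk : (0 : ℝ) ≤ k * h := by positivity
    have := norm_fderiv_le hh
      (fun z hz => (hf.iteratedFDeriv_of_isOpen isOpen_ball k z
        (mem_ball.2 (by linarith [hsub z hz]))).differentiableAt)
      (fun z hz => ih z (hsub z hz))
    rwa [norm_fderiv_iteratedFDeriv, div_div, ← pow_succ] at this

/-- The Taylor series of `f` at `x`. -/
noncomputable def taylorSeries (f : E → G) (x : E) : FormalMultilinearSeries ℂ E G :=
  fun k => (k.factorial : ℂ)⁻¹ • iteratedFDeriv ℂ k f x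

theorem norm_taylorSeries_le {f : E → G} {x : E} {r M : ℝ} (hr : 0 < r)
    (hf : AnalyticOnNhd ℂ f (ball x r)) (hM : ∀ y ∈ ball x r, ‖f y‖ ≤ M) (k : ℕ) :
    ‖taylorSeries f x k‖ ≤ M * (2 * Real.exp 1 / r) ^ k := by
  have hM0 : 0 ≤ M := (norm_nonneg _).trans (hM x (mem_ball_self hr))
  rw [taylorSeries, norm_smul, norm_inv, Complex.norm_natCast]
  rcases Nat.eq_zero_or_pos k with rfl | hk
  · simpa using hM x (mem_ball_self hr)
  have hk0 : (0 : ℝ) < k := by exact_mod_cast hk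
  -- With step `r / (2k)` the `k` Cauchy estimates use half the radius; the resulting `k ^ k / k!`
  -- is at most `e ^ k`, which leaves a geometric bound.
  have h1 := norm_iteratedFDeriv_le (h := r / (2 * k)) (by positivity) hf hM k x
    (by rw [dist_self]; field_simp; linarith)
  have h2 := Real.pow_div_factorial_le_exp (k : ℝ) hk0.le k
  have h3 : M / (r / (2 * k)) ^ k = M * (2 / r) ^ k * (k : ℝ) ^ k := by
    rw [div_eq_mul_inv, ← inv_pow, mul_assoc, ← mul_pow]
    congr 2
    field_simp
  calc (k.factorial : ℝ)⁻¹ * ‖iteratedFDeriv ℂ k f x‖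
      ≤ (k.factorial : ℝ)⁻¹ * (M * (2 / r) ^ k * (k : ℝ) ^ k) := by
        rw [← h3]; gcongr
    _ = M * (2 / r) ^ k * ((k : ℝ) ^ k / k.factorial) := by ring
    _ ≤ M * (2 / r) ^ k * Real.exp k := by gcongr
    _ = M * (2 * Real.exp 1 / r) ^ k := by
        rw [← Real.exp_one_pow, mul_assoc, ← mul_pow]
        congr 2
        ring

theorem le_radius_of_norm_le {p : FormalMultilinearSeries ℂ E G} {M κ : ℝ} (hκ : 0 < κ)
    (hp : ∀ k, ‖p k‖ ≤ M * κ ^ k) : ENNReal.ofReal κ⁻¹ ≤ p.radius := by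
  refine p.le_radius_of_bound M (r := Real.toNNReal κ⁻¹) fun k => ?_
  rw [Real.coe_toNNReal _ (by positivity), inv_pow, ← div_eq_mul_inv, div_le_iff₀ (by positivity)]
  exact hp k

/-- A bounded analytic function on a ball is the sum of its Taylor series on a ball whose radius
does not depend on the function. -/
theorem hasSum_taylorSeries [CompleteSpace G] {f : E → G} {x : E} {r M : ℝ} (hr : 0 < r)
    (hf : AnalyticOnNhd ℂ f (ball x r)) (hM : ∀ y ∈ ball x r, ‖f y‖ ≤ M) {y : E}
    (hy : ‖y‖ < (2 * Real.exp 1 / r)⁻¹) :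
    HasSum (fun k => taylorSeries f x k fun _ => y) (f (x + y)) := by
  set κ : ℝ := 2 * Real.exp 1 / r with hκ
  have he : 1 ≤ Real.exp 1 := Real.one_le_exp zero_le_one
  have hκ0 : 0 < κ := by positivity
  have hκr : κ⁻¹ ≤ r := by
    rw [hκ, inv_div, div_le_iff₀ (by positivity)]
    nlinarith
  have hrad := le_radius_of_norm_le hκ0 (norm_taylorSeries_le hr hf hM)
  set p := taylorSeries f x with hp
  have hsub : ball (0 : E) κ⁻¹ ⊆ eball (0 : E) p.radius := by
    rw [← eball_ofReal]
    exact eball_subset_eball hrad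
  have hp0 : 0 < p.radius := lt_of_lt_of_le (by simpa using hκ0) hrad
  have hsum : AnalyticOnNhd ℂ p.sum (ball 0 κ⁻¹) :=
    (p.hasFPowerSeriesOnBall hp0).analyticOnNhd.mono hsub
  have hshift : AnalyticOnNhd ℂ (fun y => f (x + y)) (ball 0 κ⁻¹) := by
    intro y hy
    have hy' : x + y ∈ ball x r := by
      rw [mem_ball, dist_self_add_left]
      exact (mem_ball_zero_iff.1 hy).trans_le hκr
    exact (hf _ hy').comp_of_eq (analyticAt_const.add analyticAt_id) rfl
  -- Analyticity gives the expansion only on a ball of unknown radius; the identity theorem then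
  -- carries it to the whole ball of radius `κ⁻¹`.
  have hloc : p.sum =ᶠ[𝓝 0] fun y => f (x + y) := by
    obtain ⟨q, ρ, hq⟩ := hf x (mem_ball_self hr)
    filter_upwards [eball_mem_nhds (0 : E) hq.r_pos, ball_mem_nhds (0 : E) (inv_pos.2 hκ0)]
      with y hy hy'
    exact (p.hasSum (hsub hy')).unique (hq.hasSum_iteratedFDeriv hy)
  have heq := hsum.eqOn_of_preconnected_of_eventuallyEq hshift
    (convex_ball (0 : E) κ⁻¹).isPreconnected (mem_ball_self (inv_pos.2 hκ0)) hloc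
  have hy' : y ∈ ball (0 : E) κ⁻¹ := mem_ball_zero_iff.2 hy
  have h := heq hy'
  simp only at h
  rw [← h]
  exact p.hasSum (hsub hy')

theorem taylorSeries_sub [CompleteSpace G] {f g : E → G} {x : E} (hf : AnalyticAt ℂ f x) (hg : AnalyticAt ℂ g x)
    (k : ℕ) : taylorSeries (f - g) x k = taylorSeries f x k - taylorSeries g x k := by
  simp only [taylorSeries]
  rw [iteratedFDeriv_sub_apply hf.contDiffAt hg.contDiffAt, smul_sub]

/-- A uniform limit of a uniformly bounded sequence of analytic functions is analytic. -/
theorem analyticAt_of_tendstoUniformlyOn [CompleteSpace G] {f : ℕ → E → G} {g : E → G} {x : E}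
    {r M : ℝ} (hr : 0 < r) (hf : ∀ n, AnalyticOnNhd ℂ (f n) (ball x r))
    (hM : ∀ n, ∀ y ∈ ball x r, ‖f n y‖ ≤ M) (hg : TendstoUniformlyOn f g atTop (ball x r)) :
    AnalyticAt ℂ g x := by
  set κ : ℝ := 2 * Real.exp 1 / r with hκ
  have hκ0 : 0 < κ := by positivity
  have hM0 : 0 ≤ M := (norm_nonneg _).trans (hM 0 x (mem_ball_self hr))
  have hκr : κ⁻¹ ≤ r := by
    rw [hκ, inv_div, div_le_iff₀ (by positivity)]
    nlinarith [Real.one_le_exp (zero_le_one (α := ℝ))]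
  -- Applying the coefficient bound to `f m - f n`, whose supremum is small, shows that the Taylor
  -- coefficients converge.
  have hcauchy : ∀ k, CauchySeq fun n => taylorSeries (f n) x k := by
    intro k
    rw [Metric.cauchySeq_iff]
    intro ε hε
    obtain ⟨N, hN⟩ := Metric.uniformCauchySeqOn_iff.1 hg.uniformCauchySeqOn
      (ε / (2 * κ ^ k)) (by positivity)
    refine ⟨N, fun m hm n hn => ?_⟩
    rw [dist_eq_norm, ← taylorSeries_sub (hf m x (mem_ball_self hr)) (hf n x (mem_ball_self hr))]
    refine (norm_taylorSeries_le hr ((hf m).sub (hf n)) (M := ε / (2 * κ ^ k))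
      (fun y hy => ?_) k).trans_lt ?_
    · rw [Pi.sub_apply, ← dist_eq_norm]
      exact (hN m hm n hn y hy).le
    · rw [← hκ]
      have : ε / (2 * κ ^ k) * κ ^ k = ε / 2 := by field_simp
      linarith
  choose q hq using fun k => cauchySeq_tendsto_of_complete (hcauchy k)
  have hqM : ∀ k, ‖q k‖ ≤ M * κ ^ k := fun k =>
    le_of_tendsto (hq k).norm (Eventually.of_forall fun n => norm_taylorSeries_le hr (hf n) (hM n) k)
  let p : FormalMultilinearSeries ℂ E G := q
  have hrad : ENNReal.ofReal κ⁻¹ ≤ p.radius := le_radius_of_norm_le hκ0 hqM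
  refine ⟨p, ENNReal.ofReal κ⁻¹, hrad, by simpa using hκ0, fun {y} hy => ?_⟩
  have hsum := p.hasSum (eball_subset_eball hrad hy)
  rw [eball_ofReal] at hy
  have hy' : ‖y‖ < κ⁻¹ := mem_ball_zero_iff.1 hy
  -- The geometric bound on the coefficients, uniform in `n`, allows the limit to be taken inside
  -- the Taylor sum.
  have hlim1 : Tendsto (fun n => ∑' k, taylorSeries (f n) x k fun _ => y) atTop
      (𝓝 (∑' k, p k fun _ => y)) := by
    refine tendsto_tsum_of_dominated_convergence (bound := fun k => M * (κ * ‖y‖) ^ k) ?_ ?_ ?_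
    · refine (summable_geometric_of_lt_one (by positivity) ?_).mul_left M
      calc κ * ‖y‖ < κ * κ⁻¹ := by gcongr
        _ = 1 := mul_inv_cancel₀ hκ0.ne'
    · exact fun k => ((ContinuousMultilinearMap.apply ℂ (fun _ : Fin k => E) G
        fun _ => y).continuous.tendsto (q k)).comp (hq k)
    · refine Eventually.of_forall fun n k => ?_
      refine (ContinuousMultilinearMap.le_opNorm _ _).trans ?_
      rw [Finset.prod_const, Finset.card_univ, Fintype.card_fin, mul_pow, ← mul_assoc]
      gcongr
      exact norm_taylorSeries_le hr (hf n) (hM n) k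
  have hlim2 : Tendsto (fun n => f n (x + y)) atTop (𝓝 (g (x + y))) := by
    refine hg.tendsto_at ?_
    rw [mem_ball, dist_self_add_left]
    exact hy'.trans_le hκr
  have heq : (fun n => ∑' k, taylorSeries (f n) x k fun _ => y) = fun n => f n (x + y) :=
    funext fun n => (hasSum_taylorSeries hr (hf n) (hM n) hy').tsum_eq
  rw [heq] at hlim1
  rw [tendsto_nhds_unique hlim2 hlim1, hsum.tsum_eq]
  exact hsum

end Analytic

/-! ### Radial derivative against invariant gradient -/

section Radial

variable {E : Type*} [NormedAddCommGroup E] [InnerProductSpace ℂ E]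

theorem smul_mem_unitBall {x : E} (hx : x ∈ ball (0 : E) 1) {t : ℝ} (ht : t ∈ Icc (0 : ℝ) 1) :
    (t : ℂ) • x ∈ ball (0 : E) 1 := by
  rw [mem_ball_zero_iff] at hx ⊢
  rw [norm_smul, Complex.norm_real, Real.norm_of_nonneg ht.1]
  nlinarith [ht.1, ht.2, norm_nonneg x]

theorem hasFDerivAt_fderiv_apply_self {g : E → ℂ} (hg : AnalyticOnNhd ℂ g (ball (0 : E) 1))
    {y : E} (hy : y ∈ ball (0 : E) 1) :
    HasFDerivAt (fun y => fderiv ℂ g y y)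
      (fderiv ℂ g y + (fderiv ℂ (fderiv ℂ g) y).flip y) y := by
  have h1 : HasFDerivAt (fderiv ℂ g) (fderiv ℂ (fderiv ℂ g) y) y :=
    (hg.fderiv y hy).differentiableAt.hasFDerivAt
  exact (h1.clm_apply (hasFDerivAt_id y)).congr_fderiv (by ext; simp)

/-- A directional derivative is the integral along a ray of that of the radial derivative. -/
theorem norm_fderiv_apply_le_of_radial {g : E → ℂ} (hg : AnalyticOnNhd ℂ g (ball (0 : E) 1))
    {x v : E} (hx : x ∈ ball (0 : E) 1) {B B' : ℝ → ℝ} (hB0 : 0 ≤ B 0)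
    (hB : ∀ t ∈ Icc (0 : ℝ) 1, HasDerivAt B (B' t) t)
    (hb : ∀ t ∈ Icc (0 : ℝ) 1, ‖fderiv ℂ (fun y => fderiv ℂ g y y) ((t : ℂ) • x) v‖ ≤ B' t) :
    ‖fderiv ℂ g x v‖ ≤ B 1 := by
  -- With `Rg(y) = g'(y)(y)`, symmetry of `g''` gives `d/dt (t g'(tx)v) = g'(tx)v + t g''(tx)(v, x)
  -- = (Rg)'(tx)v`. The factor `t` makes the function vanish at `0`, so no initial bound on `g'` is
  -- needed.
  have hder : ∀ t ∈ Icc (0 : ℝ) 1, HasDerivAt (fun t : ℝ => (t : ℂ) * fderiv ℂ g ((t : ℂ) • x) v)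
      (fderiv ℂ (fun y => fderiv ℂ g y y) ((t : ℂ) • x) v) t := by
    intro t ht
    have hmem := smul_mem_unitBall hx ht
    have h2 : HasDerivAt (fun c : ℂ => c • x) x (t : ℂ) := by
      simpa using (hasDerivAt_id (t : ℂ)).smul_const x
    have h3 := (hasDerivAt_id (t : ℂ)).mul
      ((hasFDerivAt_fderiv_apply hg hmem v).comp_hasDerivAt (t : ℂ) h2)
    refine h3.comp_ofReal.congr_deriv ?_
    have hsym : fderiv ℂ (fderiv ℂ g) ((t : ℂ) • x) x v = fderiv ℂ (fderiv ℂ g) ((t : ℂ) • x) v x :=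
      (hg _ hmem).contDiffAt.isSymmSndFDerivAt (n := 2) (by simp) x v
    rw [(hasFDerivAt_fderiv_apply_self hg hmem).fderiv]
    change 1 * fderiv ℂ g ((t : ℂ) • x) v +
        (t : ℂ) * fderiv ℂ (fderiv ℂ g) ((t : ℂ) • x) x v =
      fderiv ℂ g ((t : ℂ) • x) v + fderiv ℂ (fderiv ℂ g) ((t : ℂ) • x) v ((t : ℂ) • x)
    rw [hsym, map_smul, one_mul, smul_eq_mul]
  have key := image_norm_le_of_norm_deriv_right_le_deriv_boundary'
    (f := fun t : ℝ => (t : ℂ) * fderiv ℂ g ((t : ℂ) • x) v) (a := 0) (b := 1)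
    (fun t ht => (hder t ht).continuousAt.continuousWithinAt)
    (fun t ht => (hder t (Ico_subset_Icc_self ht)).hasDerivWithinAt)
    (B := B) (B' := B') (by simpa using hB0)
    (fun t ht => (hB t ht).continuousAt.continuousWithinAt)
    (fun t ht => (hB t (Ico_subset_Icc_self ht)).hasDerivWithinAt)
    (fun t ht => hb t (Ico_subset_Icc_self ht)) (right_mem_Icc.2 zero_le_one)
  simpa using key

/-- Orthogonality gives `‖y + c v‖² = ‖y‖² + |c|²‖v‖²`, so the Cauchy estimate can use a disc of
size comparable to `√(1 - ‖y‖²)`, much larger than the distance to the sphere. Radius `2/3 √u / ‖v‖`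
keeps `5/9` of the weight, and `(9/5) / (2/3) = 27/10 ≤ 3`. -/
theorem norm_fderiv_radial_le_of_orthogonal {g : E → ℂ}
    (hg : AnalyticOnNhd ℂ g (ball (0 : E) 1)) {N : ℝ}
    (hN : ∀ y ∈ ball (0 : E) 1, (1 - ‖y‖ ^ 2) * ‖fderiv ℂ g y y‖ ≤ N)
    {y v : E} (hy : y ∈ ball (0 : E) 1) (hyv : inner ℂ y v = 0) :
    ‖fderiv ℂ (fun y => fderiv ℂ g y y) y v‖ ≤
      3 * N * ‖v‖ / ((1 - ‖y‖ ^ 2) * √(1 - ‖y‖ ^ 2)) := by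
  rcases eq_or_ne v 0 with rfl | hv
  · simp
  have hv0 : 0 < ‖v‖ := norm_pos_iff.2 hv
  set u : ℝ := 1 - ‖y‖ ^ 2 with hu
  have hu0 : 0 < u := one_sub_sq_pos ⟨y, hy⟩
  have hN0 : 0 ≤ N := le_trans (mul_nonneg hu0.le (norm_nonneg _)) (hN y hy)
  have hs0 : 0 < √u := Real.sqrt_pos.2 hu0
  have hss : √u ^ 2 = u := Real.sq_sqrt hu0.le
  have hball : ∀ c : ℂ, ‖c‖ ≤ 2 / 3 * √u / ‖v‖ → 5 / 9 * u ≤ 1 - ‖y + c • v‖ ^ 2 := by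
    intro c hc
    rw [le_div_iff₀ hv0] at hc
    have h1 : (‖c‖ * ‖v‖) ^ 2 ≤ (2 / 3 * √u) ^ 2 := by gcongr
    have h2 := norm_add_sq_eq_norm_sq_add_norm_sq_of_inner_eq_zero (𝕜 := ℂ) y (c • v)
      (by rw [inner_smul_right, hyv, mul_zero])
    rw [norm_smul] at h2
    rw [mul_pow (2 / 3), hss] at h1
    nlinarith
  have hmem : ∀ c : ℂ, ‖c‖ ≤ 2 / 3 * √u / ‖v‖ → y + c • v ∈ ball (0 : E) 1 := by
    intro c hc
    rw [mem_ball_zero_iff]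
    have := hball c hc
    nlinarith [norm_nonneg (y + c • v)]
  have h := norm_fderiv_apply_le (f := fun y => fderiv ℂ g y y) (x := y) (v := v)
    (s := 2 / 3 * √u / ‖v‖) (M := 9 / 5 * (N / u)) (by positivity)
    (fun c hc => (hasFDerivAt_fderiv_apply_self hg (hmem c hc)).differentiableAt) (fun c hc => by
      have h3 := (mul_le_mul_of_nonneg_right (hball c hc) (norm_nonneg _)).trans
        (hN _ (hmem c hc))
      rw [mul_div_assoc', le_div_iff₀ hu0]
      linarith)
  refine h.trans ?_
  have h5 : 9 / 5 * (N / u) / (2 / 3 * √u / ‖v‖) = 27 / 10 * N * ‖v‖ / (u * √u) := by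
    field_simp
    ring
  rw [h5]
  gcongr
  norm_num

/-- The previous bound is integrated along the ray: `t / √(1 - t²‖x‖²)` is a primitive of `(1 -
t²‖x‖²)^(-3/2)`, and the integration gains one full power of the weight. -/
theorem norm_fderiv_le_of_radial_of_orthogonal {g : E → ℂ}
    (hg : AnalyticOnNhd ℂ g (ball (0 : E) 1)) {N : ℝ}
    (hN : ∀ y ∈ ball (0 : E) 1, (1 - ‖y‖ ^ 2) * ‖fderiv ℂ g y y‖ ≤ N)
    {x v : E} (hx : x ∈ ball (0 : E) 1) (hxv : inner ℂ x v = 0) :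
    √(1 - ‖x‖ ^ 2) * ‖fderiv ℂ g x v‖ ≤ 3 * N * ‖v‖ := by
  have hnorm : ∀ t ∈ Icc (0 : ℝ) 1, ‖(t : ℂ) • x‖ = t * ‖x‖ := by
    intro t ht
    rw [norm_smul, Complex.norm_real, Real.norm_of_nonneg ht.1]
  have h := norm_fderiv_apply_le_of_radial hg hx (v := v)
    (B := fun t : ℝ => 3 * N * ‖v‖ * (t / √(1 - (t * ‖x‖) ^ 2)))
    (B' := fun t : ℝ => 3 * N * ‖v‖ / ((1 - (t * ‖x‖) ^ 2) * √(1 - (t * ‖x‖) ^ 2)))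
    (by simp) (fun t ht => ?_) (fun t ht => ?_)
  · have hs0 : 0 < √(1 - ‖x‖ ^ 2) := Real.sqrt_pos.2 (one_sub_sq_pos ⟨x, hx⟩)
    rw [one_mul, mul_one_div, le_div_iff₀ hs0] at h
    rwa [mul_comm]
  · have hp : 0 < 1 - (t * ‖x‖) ^ 2 := by
      have := one_sub_sq_pos ⟨_, smul_mem_unitBall hx ht⟩
      rwa [hnorm t ht] at this
    have hs0 : 0 < √(1 - (t * ‖x‖) ^ 2) := Real.sqrt_pos.2 hp
    have hss : √(1 - (t * ‖x‖) ^ 2) ^ 2 = 1 - (t * ‖x‖) ^ 2 := Real.sq_sqrt hp.le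
    have h1 : HasDerivAt (fun t : ℝ => 1 - (t * ‖x‖) ^ 2) (-(2 * (t * ‖x‖) * ‖x‖)) t := by
      simpa using (((hasDerivAt_id t).mul_const ‖x‖).pow 2).const_sub 1
    have h2 := ((hasDerivAt_id t).div (h1.sqrt hp.ne') hs0.ne').const_mul (3 * N * ‖v‖)
    refine h2.congr_deriv ?_
    simp only [id]
    set s := √(1 - (t * ‖x‖) ^ 2) with hs
    rw [← hss]
    field_simp
    linear_combination N * ‖v‖ * hss
  · have := norm_fderiv_radial_le_of_orthogonal hg hN (smul_mem_unitBall hx ht) (v := v)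
      (by rw [inner_smul_left, hxv, mul_zero])
    rwa [hnorm t ht] at this

/-- Near the origin the radial direction degenerates and `g'(x)` cannot be read off from `g'(x)(x)`.
A Cauchy estimate at radius `1/4` stays in the ball of radius `3/4`, where the weight is at least
`7/16`; the constant is `4 * 16/7 ≤ 10`. -/
theorem norm_fderiv_le_of_radial_of_norm_le_half {g : E → ℂ}
    (hg : AnalyticOnNhd ℂ g (ball (0 : E) 1)) {N : ℝ}
    (hN : ∀ y ∈ ball (0 : E) 1, (1 - ‖y‖ ^ 2) * ‖fderiv ℂ g y y‖ ≤ N)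
    {x : E} (hx : ‖x‖ ≤ 1 / 2) (v : E) : ‖fderiv ℂ g x v‖ ≤ 10 * N * ‖v‖ := by
  have hx1 : x ∈ ball (0 : E) 1 := mem_ball_zero_iff.2 (by linarith)
  have hN0 : 0 ≤ N :=
    le_trans (mul_nonneg (one_sub_sq_pos ⟨x, hx1⟩).le (norm_nonneg _)) (hN x hx1)
  have h := norm_fderiv_apply_le_of_radial hg hx1 (v := v)
    (B := fun t : ℝ => t * (10 * N * ‖v‖)) (B' := fun _ => 10 * N * ‖v‖) (by simp)
    (fun t ht => by simpa using (hasDerivAt_id t).mul_const (10 * N * ‖v‖)) (fun t ht => ?_)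
  · simpa using h
  have hnorm : ∀ z ∈ closedBall ((t : ℂ) • x) (1 / 4 : ℝ), ‖z‖ ≤ 3 / 4 := by
    intro z hz
    have h1 : ‖(t : ℂ) • x‖ ≤ 1 / 2 := by
      rw [norm_smul, Complex.norm_real, Real.norm_of_nonneg ht.1]
      nlinarith [ht.1, ht.2, norm_nonneg x]
    rw [mem_closedBall, dist_eq_norm] at hz
    linarith [norm_sub_norm_le z ((t : ℂ) • x)]
  have hmem : ∀ z ∈ closedBall ((t : ℂ) • x) (1 / 4 : ℝ), z ∈ ball (0 : E) 1 := fun z hz =>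
    mem_ball_zero_iff.2 (by linarith [hnorm z hz])
  have h2 := norm_fderiv_le (f := fun y => fderiv ℂ g y y) (x := (t : ℂ) • x)
    (s := 1 / 4) (M := 16 / 7 * N) (by norm_num)
    (fun z hz => (hasFDerivAt_fderiv_apply_self hg (hmem z hz)).differentiableAt) (fun z hz => by
      have h3 := hN z (hmem z hz)
      have h4 : 7 / 16 ≤ 1 - ‖z‖ ^ 2 := by nlinarith [hnorm z hz, norm_nonneg z]
      nlinarith [norm_nonneg (fderiv ℂ g z z)])
  refine (ContinuousLinearMap.le_opNorm _ _).trans ?_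
  gcongr
  linarith

/-- `projP x w` is a multiple of `x`, so `L` on it is governed by `L x`, at the cost of a factor
`1/‖x‖`. -/
theorem norm_mul_norm_apply_projP_le (L : E →L[ℂ] ℂ) (x w : E) :
    ‖x‖ * ‖L (projP x w)‖ ≤ ‖w‖ * ‖L x‖ := by
  rcases eq_or_ne x 0 with rfl | hx
  · simp
  have hx0 : 0 < ‖x‖ := norm_pos_iff.2 hx
  have h1 := congrArg (fun z => ‖L z‖) (inner_smul_eq x w)
  simp only [map_smul, norm_smul, Complex.norm_real, norm_pow, norm_norm] at h1
  have h2 : ‖(inner ℂ x w : ℂ)‖ * ‖L x‖ ≤ ‖x‖ * ‖w‖ * ‖L x‖ := by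
    gcongr
    exact norm_inner_le_norm x w
  refine le_of_mul_le_mul_left ?_ hx0
  nlinarith

theorem norm_mul_norm_projP (x w : E) : ‖x‖ * ‖projP x w‖ = ‖(inner ℂ x w : ℂ)‖ := by
  rcases eq_or_ne x 0 with rfl | hx
  · simp
  have hx0 : 0 < ‖x‖ := norm_pos_iff.2 hx
  have h1 := congrArg norm (inner_smul_eq x w)
  simp only [norm_smul, Complex.norm_real, norm_pow, norm_norm] at h1
  refine mul_left_cancel₀ hx0.ne' ?_
  linarith

theorem norm_sub_projP_le (x w : E) : ‖w - projP x w‖ ≤ 2 * ‖w‖ := by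
  linarith [norm_sub_le w (projP x w), norm_projP_le x w]

/-- The invariant gradient is controlled by the radial derivative. -/
theorem invGradNorm_le_of_radial {f : ball (0 : E) 1 → ℂ} (hf : IsAnalytic f) {N : ℝ}
    (hN : ∀ y : ball (0 : E) 1, (1 - ‖(y : E)‖ ^ 2) * ‖radialDeriv f y‖ ≤ N)
    (x : ball (0 : E) 1) : invGradNorm f x ≤ 16 * N := by
  have hp := one_sub_sq_pos x
  have hN0 : 0 ≤ N := le_trans (mul_nonneg hp.le (norm_nonneg _)) (hN x)
  have hN' : ∀ y ∈ ball (0 : E) 1, (1 - ‖y‖ ^ 2) * ‖fderiv ℂ (zeroExt f) y y‖ ≤ N :=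
    fun y hy => hN ⟨y, hy⟩
  rw [invGradNorm, fderiv_comp_moebius hf]
  refine ContinuousLinearMap.opNorm_le_bound _ (by positivity) fun w => ?_
  have h1 : (1 - ‖(x : E)‖ ^ 2) * ‖ballDeriv f x (projP (x : E) w)‖ ≤ 10 * N * ‖w‖ := by
    -- Away from the origin the component along `x` is read off from the radial derivative, losing a
    -- factor `2`; near the origin the separate estimate is used.
    rcases le_total ‖(x : E)‖ (1 / 2) with hx | hx
    · have h2 := norm_fderiv_le_of_radial_of_norm_le_half hf hN' hx (projP (x : E) w)
      have h3 : 10 * N * ‖projP (x : E) w‖ ≤ 10 * N * ‖w‖ := by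
        gcongr
        exact norm_projP_le _ _
      refine le_trans ?_ (h2.trans h3)
      exact mul_le_of_le_one_left (norm_nonneg _) (by nlinarith [norm_nonneg (x : E)])
    · have h2 := norm_mul_norm_apply_projP_le (ballDeriv f x) (x : E) w
      have h3 : ‖ballDeriv f x (projP (x : E) w)‖ ≤ 2 * (‖w‖ * ‖ballDeriv f x x‖) := by
        nlinarith [norm_nonneg (ballDeriv f x (projP (x : E) w))]
      calc _ ≤ (1 - ‖(x : E)‖ ^ 2) * (2 * (‖w‖ * ‖ballDeriv f x x‖)) := by gcongr
        _ = 2 * ‖w‖ * ((1 - ‖(x : E)‖ ^ 2) * ‖radialDeriv f x‖) := by rw [radialDeriv]; ring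
        _ ≤ 2 * ‖w‖ * N := by gcongr; exact hN x
        _ ≤ 10 * N * ‖w‖ := by nlinarith [mul_nonneg hN0 (norm_nonneg w)]
  have h2 : √(1 - ‖(x : E)‖ ^ 2) * ‖ballDeriv f x (w - projP (x : E) w)‖ ≤ 6 * N * ‖w‖ := by
    have h := norm_fderiv_le_of_radial_of_orthogonal hf hN' x.2 (inner_sub_projP (x : E) w)
    refine h.trans ?_
    nlinarith [norm_sub_projP_le (x : E) w]
  rw [ContinuousLinearMap.comp_apply, moebiusDeriv_apply, map_neg, norm_neg, map_add, map_smul,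
    map_smul]
  refine (norm_add_le _ _).trans ?_
  rw [norm_smul, norm_smul, Complex.norm_real, Complex.norm_real, Real.norm_of_nonneg hp.le,
    Real.norm_of_nonneg (Real.sqrt_nonneg _)]
  linarith

/-- `φ_x'(0)` is `-(1 - ‖x‖²)` on `ℂx` and `-√(1 - ‖x‖²)` on its orthogonal complement; inverting it
recovers `f'(x)` from the invariant gradient with the weight proper to each direction. -/
theorem norm_ballDeriv_apply_le {f : ball (0 : E) 1 → ℂ} (hf : IsAnalytic f)
    (x : ball (0 : E) 1) (w : E) :
    ‖ballDeriv f x w‖ ≤ invGradNorm f x * (‖projP (x : E) w‖ / (1 - ‖(x : E)‖ ^ 2) +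
      ‖w - projP (x : E) w‖ / √(1 - ‖(x : E)‖ ^ 2)) := by
  have hp := one_sub_sq_pos x
  have hs := Real.sqrt_pos.2 hp
  set c : ℝ := 1 - ‖(x : E)‖ ^ 2 with hc
  set P := projP (x : E) with hP
  have hPP : P (P w) = P w := projP_proj _ w
  have hD : moebiusDeriv (x : E)
      (-(((c⁻¹ : ℝ) : ℂ) • P w + (((√c)⁻¹ : ℝ) : ℂ) • (w - P w))) = w := by
    have h1 : (c : ℂ) ≠ 0 := by exact_mod_cast hp.ne'
    have h2 : ((√c : ℝ) : ℂ) ≠ 0 := by exact_mod_cast hs.ne'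
    rw [moebiusDeriv_apply, ← hP, ← hc]
    simp only [map_neg, map_add, map_smul, map_sub, hPP, sub_self, smul_zero, add_zero]
    push_cast
    match_scalars <;> field_simp
    ring
  have h3 := (fderiv ℂ (fun y => zeroExt f (moebius (x : E) y)) 0).le_opNorm
    (-(((c⁻¹ : ℝ) : ℂ) • P w + (((√c)⁻¹ : ℝ) : ℂ) • (w - P w)))
  rw [← invGradNorm, fderiv_comp_moebius hf, ContinuousLinearMap.comp_apply, hD] at h3
  refine h3.trans ?_
  have : 0 ≤ invGradNorm f x := norm_nonneg _
  gcongr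
  rw [norm_neg]
  refine (norm_add_le _ _).trans_eq ?_
  rw [norm_smul, norm_smul, Complex.norm_real, Complex.norm_real,
    Real.norm_of_nonneg (inv_nonneg.2 hp.le), Real.norm_of_nonneg (inv_nonneg.2 hs.le)]
  ring

theorem one_sub_sq_mul_norm_ballDeriv_le {f : ball (0 : E) 1 → ℂ} (hf : IsAnalytic f)
    (x : ball (0 : E) 1) : (1 - ‖(x : E)‖ ^ 2) * ‖ballDeriv f x‖ ≤ 3 * invGradNorm f x := by
  have hp := one_sub_sq_pos x
  have hn : 0 ≤ invGradNorm f x := norm_nonneg _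
  rw [mul_comm, ← le_div_iff₀ hp]
  refine ContinuousLinearMap.opNorm_le_bound _ (by positivity) fun w => ?_
  have hs : 1 - ‖(x : E)‖ ^ 2 ≤ √(1 - ‖(x : E)‖ ^ 2) :=
    Real.le_sqrt_of_sq_le (by nlinarith [sq_nonneg ‖(x : E)‖])
  calc ‖ballDeriv f x w‖ ≤ invGradNorm f x * (‖w‖ / (1 - ‖(x : E)‖ ^ 2) +
        2 * ‖w‖ / (1 - ‖(x : E)‖ ^ 2)) := by
        refine (norm_ballDeriv_apply_le hf x w).trans ?_
        gcongr
        · exact norm_projP_le _ _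
        · exact norm_sub_projP_le _ _
    _ = 3 * invGradNorm f x / (1 - ‖(x : E)‖ ^ 2) * ‖w‖ := by ring

end Radial

/-! ### Completeness of the Bloch space -/

section Complete

/-- This is the Cauchy estimate applied to `f n - g` on the ball of half the radius. -/
theorem tendsto_fderiv_of_tendstoUniformlyOn {E G : Type*} [NormedAddCommGroup E] [NormedSpace ℂ E]
    [NormedAddCommGroup G] [NormedSpace ℂ G] {f : ℕ → E → G} {g : E → G} {x : E} {r : ℝ}
    (hr : 0 < r) (hf : ∀ n, ∀ y ∈ ball x r, DifferentiableAt ℂ (f n) y)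
    (hg : ∀ y ∈ ball x r, DifferentiableAt ℂ g y) (h : TendstoUniformlyOn f g atTop (ball x r)) :
    Tendsto (fun n => fderiv ℂ (f n) x) atTop (𝓝 (fderiv ℂ g x)) := by
  rw [Metric.tendsto_nhds]
  intro ε hε
  have hsub : closedBall x (r / 2) ⊆ ball x r := closedBall_subset_ball (by linarith)
  filter_upwards [Metric.tendstoUniformlyOn_iff.1 h (ε * r / 4) (by positivity)] with n hn
  rw [dist_eq_norm, ← fderiv_sub (hf n x (mem_ball_self hr)) (hg x (mem_ball_self hr))]
  refine (norm_fderiv_le (s := r / 2) (M := ε * r / 4) (by positivity)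
    (fun y hy => (hf n y (hsub hy)).sub (hg y (hsub hy))) (fun y hy => ?_)).trans_lt ?_
  · rw [Pi.sub_apply, ← dist_eq_norm, dist_comm]
    exact (hn y (hsub hy)).le
  · rw [div_lt_iff₀ (by positivity)]
    nlinarith

variable {E : Type*} [NormedAddCommGroup E] [InnerProductSpace ℂ E]

theorem ballDeriv_sub {f g : ball (0 : E) 1 → ℂ} (hf : IsAnalytic f) (hg : IsAnalytic g)
    (x : ball (0 : E) 1) : ballDeriv (f - g) x = ballDeriv f x - ballDeriv g x := by
  have h : zeroExt (f - g) = zeroExt f - zeroExt g := by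
    rw [sub_eq_add_neg, zeroExt_add, ← neg_one_smul ℂ g, zeroExt_smul, neg_one_smul,
      ← sub_eq_add_neg]
  rw [ballDeriv, h, fderiv_sub (hf.differentiableAt x) (hg.differentiableAt x)]
  rfl

namespace Bloch

theorem coe_sub (f g : Bloch E) : ⇑(f - g) = f - g := rfl

theorem invGradNorm_le_norm (f : Bloch E) (x : ball (0 : E) 1) :
    ‖f ballZero‖ + invGradNorm f x ≤ ‖f‖ := by
  rw [norm_def]
  gcongr
  exact le_ciSup f.isBloch.bddAbove_invGradNorm x

theorem norm_le_of_forall {f : Bloch E} {c : ℝ}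
    (h : ∀ x, ‖f ballZero‖ + invGradNorm f x ≤ c) : ‖f‖ ≤ c := by
  have hne : Nonempty (ball (0 : E) 1) := ⟨ballZero⟩
  rw [norm_def]
  have : ⨆ x, invGradNorm f x ≤ c - ‖f ballZero‖ := ciSup_le fun x => by linarith [h x]
  linarith

theorem invGradNorm_sub (f g : Bloch E) (x : ball (0 : E) 1) :
    invGradNorm ⇑(f - g) x =
      ‖(ballDeriv f x - ballDeriv g x).comp (moebiusDeriv (x : E))‖ := by
  rw [invGradNorm, fderiv_comp_moebius (f - g).isBloch.1, coe_sub,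
    ballDeriv_sub f.isBloch.1 g.isBloch.1]

theorem norm_ballDeriv_le (f : Bloch E) {ρ : ℝ} (hρ : ρ < 1) {x : ball (0 : E) 1}
    (hx : ‖(x : E)‖ ≤ ρ) : ‖ballDeriv f x‖ ≤ 3 / (1 - ρ ^ 2) * ‖f‖ := by
  have hρ0 : 0 ≤ ρ := (norm_nonneg _).trans hx
  have h0 : 0 < 1 - ρ ^ 2 := by nlinarith
  have h1 := one_sub_sq_mul_norm_ballDeriv_le f.isBloch.1 x
  have h2 := f.invGradNorm_le_norm x
  have h3 : (1 - ρ ^ 2) * ‖ballDeriv f x‖ ≤ (1 - ‖(x : E)‖ ^ 2) * ‖ballDeriv f x‖ := by gcongr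
  rw [div_mul_eq_mul_div, le_div_iff₀ h0]
  linarith [norm_nonneg (f ballZero)]

/-- Integrating the derivative bound from the origin shows that point evaluations are bounded,
uniformly on smaller balls. -/
theorem norm_apply_le (f : Bloch E) {ρ : ℝ} (hρ : ρ < 1) {x : ball (0 : E) 1}
    (hx : ‖(x : E)‖ ≤ ρ) : ‖f x‖ ≤ (1 + 3 / (1 - ρ ^ 2)) * ‖f‖ := by
  have hρ0 : 0 ≤ ρ := (norm_nonneg _).trans hx
  have h0 : 0 < 1 - ρ ^ 2 := by nlinarith
  have hmem : ∀ y ∈ closedBall (0 : E) ρ, y ∈ ball (0 : E) 1 := fun y hy =>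
    closedBall_subset_ball hρ hy
  have h := Convex.norm_image_sub_le_of_norm_fderiv_le (𝕜 := ℂ) (f := zeroExt f)
    (s := closedBall (0 : E) ρ) (C := 3 / (1 - ρ ^ 2) * ‖f‖) (x := 0) (y := (x : E))
    (fun y hy => f.isBloch.1.differentiableAt ⟨y, hmem y hy⟩)
    (fun y hy => f.norm_ballDeriv_le hρ (x := ⟨y, hmem y hy⟩) (mem_closedBall_zero_iff.1 hy))
    (convex_closedBall _ _) (mem_closedBall_self hρ0) (mem_closedBall_zero_iff.2 hx)
  rw [zeroExt_coe, show zeroExt f (0 : E) = f ballZero from zeroExt_coe _ ballZero, sub_zero] at h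
  have h2 : 3 / (1 - ρ ^ 2) * ‖f‖ * ‖(x : E)‖ ≤ 3 / (1 - ρ ^ 2) * ‖f‖ :=
    mul_le_of_le_one_right (by positivity) (hx.trans hρ.le)
  have h3 := f.invGradNorm_le_norm ballZero
  have h4 : 0 ≤ invGradNorm f ballZero := norm_nonneg _
  linarith [norm_sub_norm_le (f x) (f ballZero)]

/-- The derivative of a Bloch function is Lipschitz on smaller balls. -/
theorem norm_ballDeriv_sub_le (f : Bloch E) {δ : ℝ} (hδ : δ < 1) {x y : ball (0 : E) 1}
    (hx : ‖(x : E)‖ ≤ δ) (hy : ‖(y : E)‖ ≤ δ) :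
    ‖ballDeriv f y - ballDeriv f x‖ ≤
      3 / (1 - ((1 + δ) / 2) ^ 2) * ‖f‖ / ((1 - δ) / 2) * ‖(y : E) - x‖ := by
  -- The midpoint `(1 + δ) / 2` leaves room for a Cauchy estimate of radius `(1 - δ) / 2` applied to
  -- `f'` around every point of the ball of radius `δ`.
  have hnorm : ∀ z ∈ closedBall (0 : E) δ, ∀ w ∈ closedBall z ((1 - δ) / 2),
      ‖w‖ ≤ (1 + δ) / 2 := by
    intro z hz w hw
    rw [mem_closedBall_zero_iff] at hz
    rw [mem_closedBall, dist_eq_norm] at hw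
    linarith [norm_sub_norm_le w z]
  have hmem : ∀ z ∈ closedBall (0 : E) δ, ∀ w ∈ closedBall z ((1 - δ) / 2),
      w ∈ ball (0 : E) 1 := fun z hz w hw =>
    mem_ball_zero_iff.2 (by linarith [hnorm z hz w hw])
  refine Convex.norm_image_sub_le_of_norm_fderiv_le (𝕜 := ℂ) (f := fderiv ℂ (zeroExt f))
    (s := closedBall (0 : E) δ) (x := (x : E)) (y := (y : E)) (fun z hz => ?_) (fun z hz => ?_)
    (convex_closedBall _ _) (mem_closedBall_zero_iff.2 hx) (mem_closedBall_zero_iff.2 hy)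
  · exact (f.isBloch.1.fderiv z (closedBall_subset_ball hδ hz)).differentiableAt
  · exact norm_fderiv_le (by linarith)
      (fun w hw => (f.isBloch.1.fderiv w (hmem z hz w hw)).differentiableAt)
      (fun w hw => f.norm_ballDeriv_le (by linarith) (x := ⟨w, hmem z hz w hw⟩) (hnorm z hz w hw))

/-- A Cauchy sequence of Bloch functions is locally uniformly Cauchy. -/
theorem uniformCauchySeqOn {u : ℕ → Bloch E} (hu : CauchySeq u) {ρ : ℝ} (hρ0 : 0 ≤ ρ)
    (hρ : ρ < 1) :
    UniformCauchySeqOn (fun n => zeroExt (u n)) atTop (closedBall (0 : E) ρ) := by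
  have h0 : 0 < 1 - ρ ^ 2 := by nlinarith
  rw [Metric.uniformCauchySeqOn_iff]
  intro ε hε
  obtain ⟨N, hN⟩ := Metric.cauchySeq_iff.1 hu (ε / (1 + 3 / (1 - ρ ^ 2))) (by positivity)
  refine ⟨N, fun m hm n hn y hy => ?_⟩
  have hy1 := closedBall_subset_ball hρ hy
  have h1 := (u m - u n).norm_apply_le hρ (x := ⟨y, hy1⟩) (mem_closedBall_zero_iff.1 hy)
  have h2 := hN m hm n hn
  rw [dist_eq_norm, lt_div_iff₀ (by positivity)] at h2
  rw [dist_eq_norm, zeroExt_of_mem _ hy1, zeroExt_of_mem _ hy1]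
  rw [coe_sub, Pi.sub_apply] at h1
  linarith

/-- The locally uniform limit is analytic, its derivatives are the pointwise limits of the
derivatives, and the norm is a supremum of quantities depending only on `f(0)` and `f'(x)`. Bounds
on `u n` and on `u m - u n` therefore pass to the limit. -/
theorem exists_tendsto_of_cauchySeq {u : ℕ → Bloch E} (hu : CauchySeq u) :
    ∃ g : Bloch E, Tendsto u atTop (𝓝 g) := by
  have hpt : ∀ x : ball (0 : E) 1, ∃ c : ℂ, Tendsto (fun n => u n x) atTop (𝓝 c) := by
    intro x
    have h := (uniformCauchySeqOn hu (norm_nonneg (x : E)) (mem_ball_zero_iff.1 x.2)).cauchySeq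
      (mem_closedBall_zero_iff.2 le_rfl)
    simp only [zeroExt_coe] at h
    exact cauchySeq_tendsto_of_complete h
  choose g hg using hpt
  obtain ⟨R, hR⟩ := isBounded_iff_forall_norm_le.1 hu.isBounded_range
  have hR' : ∀ n, ‖u n‖ ≤ R := fun n => hR _ (mem_range_self n)
  have hR0 : 0 ≤ R := (norm_nonneg _).trans (hR' 0)
  have hloc : ∀ x : ball (0 : E) 1, ∃ r > 0, ball (x : E) r ⊆ ball (0 : E) 1 ∧
      TendstoUniformlyOn (fun n => zeroExt (u n)) (zeroExt g) atTop (ball (x : E) r) ∧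
      ∃ M, ∀ n, ∀ y ∈ ball (x : E) r, ‖zeroExt (u n) y‖ ≤ M := by
    intro x
    have hx1 : ‖(x : E)‖ < 1 := mem_ball_zero_iff.1 x.2
    have hρ : (1 + ‖(x : E)‖) / 2 < 1 := by linarith
    have hsub : ball (x : E) ((1 - ‖(x : E)‖) / 2) ⊆ closedBall 0 ((1 + ‖(x : E)‖) / 2) := by
      intro y hy
      rw [mem_ball, dist_eq_norm] at hy
      rw [mem_closedBall_zero_iff]
      linarith [norm_sub_norm_le y x]
    refine ⟨(1 - ‖(x : E)‖) / 2, by linarith, hsub.trans (closedBall_subset_ball hρ), ?_,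
      (1 + 3 / (1 - ((1 + ‖(x : E)‖) / 2) ^ 2)) * R, ?_⟩
    · refine ((uniformCauchySeqOn hu (by positivity) hρ).mono hsub).tendstoUniformlyOn_of_tendsto
        fun y hy => ?_
      have hy1 := closedBall_subset_ball hρ (hsub hy)
      simpa only [zeroExt_of_mem _ hy1] using hg ⟨y, hy1⟩
    · intro n y hy
      have hy1 := closedBall_subset_ball hρ (hsub hy)
      rw [zeroExt_of_mem _ hy1]
      refine ((u n).norm_apply_le hρ (mem_closedBall_zero_iff.1 (hsub hy))).trans ?_
      have h0 : 0 < 1 - ((1 + ‖(x : E)‖) / 2) ^ 2 := by nlinarith [norm_nonneg (x : E)]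
      gcongr
      exact hR' n
  have hga : IsAnalytic g := by
    intro x hx
    obtain ⟨r, hr, hsub, hlim, M, hM⟩ := hloc ⟨x, hx⟩
    exact analyticAt_of_tendstoUniformlyOn hr (fun n => (u n).isBloch.1.mono hsub) hM hlim
  have hderiv : ∀ x, Tendsto (fun n => ballDeriv (u n) x) atTop (𝓝 (ballDeriv g x)) := by
    intro x
    obtain ⟨r, hr, hsub, hlim, -⟩ := hloc x
    exact tendsto_fderiv_of_tendstoUniformlyOn hr
      (fun n y hy => (u n).isBloch.1.differentiableAt ⟨y, hsub hy⟩)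
      (fun y hy => hga.differentiableAt ⟨y, hsub hy⟩) hlim
  have hgb : IsBloch g := by
    refine ⟨hga, 3 * R, ?_⟩
    rintro _ ⟨x, rfl⟩
    refine le_of_tendsto ((hderiv x).norm.const_mul (1 - ‖(x : E)‖ ^ 2))
      (Eventually.of_forall fun n => ?_)
    have h1 := one_sub_sq_mul_norm_ballDeriv_le (u n).isBloch.1 x
    linarith [(u n).invGradNorm_le_norm x, hR' n, norm_nonneg (u n ballZero)]
  let G : Bloch E := ⟨g, hgb⟩
  refine ⟨G, Metric.tendsto_atTop.2 fun ε hε => ?_⟩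
  obtain ⟨N, hN⟩ := Metric.cauchySeq_iff.1 hu (ε / 2) (by positivity)
  refine ⟨N, fun m hm => ?_⟩
  rw [dist_eq_norm]
  refine (norm_le_of_forall (c := ε / 2) fun x => ?_).trans_lt (by linarith)
  -- The limit in `n` is taken at a fixed point `x`; since the Cauchy bound does not depend on `x`,
  -- the supremum can be taken afterwards.
  have hlim : Tendsto (fun n => ‖(u m - u n) ballZero‖ + invGradNorm ⇑(u m - u n) x) atTop
      (𝓝 (‖(u m - G) ballZero‖ + invGradNorm ⇑(u m - G) x)) := by
    refine Tendsto.add ((tendsto_const_nhds.sub (hg ballZero)).norm) ?_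
    simp only [invGradNorm_sub]
    have hc : Continuous fun L : E →L[ℂ] ℂ =>
        ‖(ballDeriv (u m) x - L).comp (moebiusDeriv (x : E))‖ := by fun_prop
    exact (hc.tendsto _).comp (hderiv x)
  refine le_of_tendsto hlim (eventually_atTop.2 ⟨N, fun n hn => ?_⟩)
  exact ((u m - u n).invGradNorm_le_norm x).trans (by
    rw [← dist_eq_norm]
    exact (hN m hm n hn).le)

instance : CompleteSpace (Bloch E) :=
  Metric.complete_of_cauchySeq_tendsto fun _ hu => exists_tendsto_of_cauchySeq hu

end Bloch

end Complete

/-- Bounded subsets of `ℂ^ι` are totally bounded for finite `ι`. A finite net of `Φ '' s`, chosen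
inside it, lifts to finitely many points of `s` whose images under `F` form an `ε`-net. -/
theorem totallyBounded_image_of_approx.{u, v, w} {X : Type u} {Y : Type v} [PseudoMetricSpace Y] {s : Set X} {F : X → Y}
    (h : ∀ ε > 0, ∃ (ι : Type w) (_ : Fintype ι) (Φ : X → ι → ℂ), Bornology.IsBounded (Φ '' s) ∧
      ∃ η > 0, ∀ a ∈ s, ∀ b ∈ s, dist (Φ a) (Φ b) < η → dist (F a) (F b) < ε) :
    TotallyBounded (F '' s) := by
  rw [Metric.totallyBounded_iff]
  intro ε hε
  obtain ⟨ι, _, Φ, hb, η, hη, hΦ⟩ := h ε hε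
  obtain ⟨t, hts, htf, hcov⟩ := Metric.finite_approx_of_totallyBounded
    (hb.isCompact_closure.totallyBounded.subset subset_closure) η hη
  obtain ⟨t', ht's, ht'f, rfl⟩ := Set.exists_subset_image_finite_and.1 ⟨t, hts, htf, rfl⟩
  refine ⟨F '' t', ht'f.image F, ?_⟩
  rintro _ ⟨a, ha, rfl⟩
  obtain ⟨_, ⟨b, hb, rfl⟩, hab⟩ := mem_iUnion₂.1 (hcov (mem_image_of_mem Φ ha))
  exact mem_iUnion₂.2 ⟨F b, mem_image_of_mem F hb, hΦ a ha b (ht's hb) hab⟩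

/-! ### Composition with `φ`: pulled-back derivatives, boundedness and compactness -/

section Composition

variable {E : Type*} [NormedAddCommGroup E] [InnerProductSpace ℂ E]
  {φ : ball (0 : E) 1 → ball (0 : E) 1}

theorem zeroExt_comp_eventuallyEq (f : ball (0 : E) 1 → ℂ) (φ : ball (0 : E) 1 → ball (0 : E) 1)
    {x : E} (hx : x ∈ ball (0 : E) 1) :
    zeroExt f ∘ zeroExt (fun z => (φ z : E)) =ᶠ[𝓝 x] zeroExt fun z => f (φ z) := by
  filter_upwards [isOpen_ball.mem_nhds hx] with y hy
  rw [Function.comp_apply, zeroExt_of_mem _ hy, zeroExt_of_mem _ hy, zeroExt_coe]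

theorem IsAnalytic.comp {f : ball (0 : E) 1 → ℂ} (hf : IsAnalytic f)
    (hφ : IsAnalytic fun z => (φ z : E)) : IsAnalytic fun z => f (φ z) := by
  intro x hx
  refine AnalyticAt.congr ?_ (zeroExt_comp_eventuallyEq f φ hx)
  exact (hf _ (φ ⟨x, hx⟩).2).comp_of_eq (hφ x hx) (zeroExt_of_mem _ hx)

theorem radialDeriv_comp {f : ball (0 : E) 1 → ℂ} (hf : IsAnalytic f)
    (hφ : IsAnalytic fun z => (φ z : E)) (z : ball (0 : E) 1) :
    radialDeriv (fun z => f (φ z)) z =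
      ballDeriv f (φ z) (radialDeriv (fun z => (φ z : E)) z) := by
  have h1 : HasFDerivAt (zeroExt f) (ballDeriv f (φ z)) (zeroExt (fun z => (φ z : E)) z) := by
    rw [zeroExt_coe]
    exact (hf.differentiableAt (φ z)).hasFDerivAt
  have h2 := (h1.comp (z : E) (hφ.differentiableAt z).hasFDerivAt).congr_of_eventuallyEq
    (zeroExt_comp_eventuallyEq f φ z.2).symm
  rw [radialDeriv, ballDeriv, h2.fderiv]
  rfl

/-- The weighted radial derivative `(1 - ‖z‖²) Rφ(z)`. -/
noncomputable def weightedRadial (φ : ball (0 : E) 1 → ball (0 : E) 1) (z : ball (0 : E) 1) : E :=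
  (1 - ‖(z : E)‖ ^ 2) • radialDeriv (fun z => (φ z : E)) z

theorem norm_weightedRadial (φ : ball (0 : E) 1 → ball (0 : E) 1) (z : ball (0 : E) 1) :
    ‖weightedRadial φ z‖ =
      (1 - ‖(z : E)‖ ^ 2) * ‖radialDeriv (fun z => (φ z : E)) z‖ := by
  rw [weightedRadial, norm_smul, Real.norm_of_nonneg (one_sub_sq_pos z).le]

theorem norm_inner_weightedRadial (φ : ball (0 : E) 1 → ball (0 : E) 1) (z : ball (0 : E) 1) :
    ‖(inner ℂ (φ z : E) (weightedRadial φ z) : ℂ)‖ = (1 - ‖(z : E)‖ ^ 2) *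
      ‖(inner ℂ (φ z : E) (radialDeriv (fun z => (φ z : E)) z) : ℂ)‖ := by
  rw [weightedRadial, inner_smul_right_eq_smul, norm_smul,
    Real.norm_of_nonneg (one_sub_sq_pos z).le]

theorem one_sub_sq_mul_norm_radialDeriv_comp {f : ball (0 : E) 1 → ℂ} (hf : IsAnalytic f)
    (hφ : IsAnalytic fun z => (φ z : E)) (z : ball (0 : E) 1) :
    (1 - ‖(z : E)‖ ^ 2) * ‖radialDeriv (fun z => f (φ z)) z‖ =
      ‖ballDeriv f (φ z) (weightedRadial φ z)‖ := by
  rw [radialDeriv_comp hf hφ, weightedRadial, ContinuousLinearMap.map_smul_of_tower, norm_smul,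
    Real.norm_of_nonneg (one_sub_sq_pos z).le]

/-- Pulled-back invariant gradients are small where `φ` is close to the sphere. -/
theorem exists_norm_apply_weightedRadial_le
    (h_lim_norm : Tendsto
      (fun z : ball (0 : E) 1 => ‖weightedRadial φ z‖ / √(1 - ‖(φ z : E)‖ ^ 2))
      (comap (fun z => ‖(φ z : E)‖) (𝓝 1)) (𝓝 0))
    (h_lim_inner : Tendsto
      (fun z : ball (0 : E) 1 =>
        ‖(inner ℂ (φ z : E) (weightedRadial φ z) : ℂ)‖ / (1 - ‖(φ z : E)‖ ^ 2))
      (comap (fun z => ‖(φ z : E)‖) (𝓝 1)) (𝓝 0)) {η : ℝ} (hη : 0 < η) :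
    ∃ δ : ℝ, 0 < δ ∧ δ < 1 ∧ ∀ (f : Bloch E) (z : ball (0 : E) 1), δ < ‖(φ z : E)‖ →
      ‖ballDeriv f (φ z) (weightedRadial φ z)‖ ≤ η * ‖f‖ := by
  have h1 := (h_lim_norm.eventually (gt_mem_nhds (show (0 : ℝ) < η / 4 by positivity))).and
    (h_lim_inner.eventually (gt_mem_nhds (show (0 : ℝ) < η / 4 by positivity)))
  obtain ⟨V, hV, hVs⟩ := Filter.mem_comap.1 h1
  obtain ⟨r, hr, hrV⟩ := Metric.mem_nhds_iff.1 hV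
  -- The bound `1 - r` enters the neighbourhood where both ratios are below `η / 4`; the bound `1/2`
  -- lets the inner product with `φ z` control the projection up to a factor `2`. In total, `2 * η/4
  -- + 2 * η/4 = η`.
  refine ⟨max (1 / 2) (1 - r), lt_max_of_lt_left (by norm_num),
    max_lt (by norm_num) (by linarith), fun f z hz => ?_⟩
  obtain ⟨hz1, hz2⟩ := max_lt_iff.1 hz
  have hw1 : ‖(φ z : E)‖ < 1 := mem_ball_zero_iff.1 (φ z).2
  have hmem : ‖(φ z : E)‖ ∈ V := hrV (by
    rw [mem_ball, Real.dist_eq, abs_lt]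
    constructor <;> linarith)
  obtain ⟨ha, hb⟩ := hVs hmem
  have hp := one_sub_sq_pos (φ z)
  have hs := Real.sqrt_pos.2 hp
  have hproj : ‖projP (φ z : E) (weightedRadial φ z)‖ ≤
      2 * ‖(inner ℂ (φ z : E) (weightedRadial φ z) : ℂ)‖ := by
    rw [← norm_mul_norm_projP]
    nlinarith [norm_nonneg (projP (φ z : E) (weightedRadial φ z))]
  have hle : ‖projP (φ z : E) (weightedRadial φ z)‖ / (1 - ‖(φ z : E)‖ ^ 2) +
      ‖weightedRadial φ z - projP (φ z : E) (weightedRadial φ z)‖ / √(1 - ‖(φ z : E)‖ ^ 2) ≤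
      η := by
    calc _ ≤ 2 * ‖(inner ℂ (φ z : E) (weightedRadial φ z) : ℂ)‖ / (1 - ‖(φ z : E)‖ ^ 2) +
          2 * ‖weightedRadial φ z‖ / √(1 - ‖(φ z : E)‖ ^ 2) := by
          gcongr
          exact norm_sub_projP_le _ _
      _ ≤ η := by
          rw [mul_div_assoc, mul_div_assoc]
          linarith
  have hf := f.invGradNorm_le_norm (φ z)
  have hf0 : 0 ≤ invGradNorm f (φ z) := norm_nonneg _
  calc _ ≤ _ := norm_ballDeriv_apply_le f.isBloch.1 (φ z) (weightedRadial φ z)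
    _ ≤ invGradNorm f (φ z) * η := by gcongr
    _ ≤ ‖f‖ * η := by gcongr; linarith [norm_nonneg (f ballZero)]
    _ = η * ‖f‖ := mul_comm _ _

theorem isBounded_weightedRadial {δ : ℝ}
    (h : IsCompact (closure (weightedRadial φ '' {z | ‖(φ z : E)‖ ≤ δ}))) :
    ∃ K, 0 < K ∧ ∀ z, ‖(φ z : E)‖ ≤ δ → ‖weightedRadial φ z‖ ≤ K := by
  obtain ⟨K, hK0, hK⟩ := h.isBounded.exists_pos_norm_le
  exact ⟨K, hK0, fun z hz => hK _ (subset_closure (mem_image_of_mem _ hz))⟩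

/-- The pull-back is controlled by finitely many point evaluations where `φ` stays away from the
sphere. -/
theorem exists_finite_approx {δ : ℝ} (hδ : δ < 1)
    (h_range : IsCompact (closure ((fun z => (φ z : E)) '' {z | ‖(φ z : E)‖ ≤ δ})))
    (h_radial : IsCompact (closure (weightedRadial φ '' {z | ‖(φ z : E)‖ ≤ δ})))
    {η : ℝ} (hη : 0 < η) :
    ∃ T : Set (ball (0 : E) 1), T.Finite ∧ ∀ z, ‖(φ z : E)‖ ≤ δ → ∃ z' ∈ T, ∀ f : Bloch E,
      ‖ballDeriv f (φ z) (weightedRadial φ z)‖ ≤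
        ‖ballDeriv f (φ z') (weightedRadial φ z')‖ + η * ‖f‖ := by
  rcases lt_or_ge δ 0 with hneg | hδ0
  · exact ⟨∅, finite_empty, fun z hz => absurd (norm_nonneg (φ z : E)) (by linarith)⟩
  obtain ⟨K, hK0, hK⟩ := isBounded_weightedRadial h_radial
  have h1 : 0 < 1 - δ ^ 2 := by nlinarith
  have h2 : 0 < 1 - ((1 + δ) / 2) ^ 2 := by nlinarith
  have h3 : 0 < (1 - δ) / 2 := by linarith
  set A : ℝ := 3 / (1 - δ ^ 2) with hA
  set L : ℝ := 3 / (1 - ((1 + δ) / 2) ^ 2) / ((1 - δ) / 2) with hL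
  have hA0 : 0 < A := by positivity
  have hL0 : 0 < L := by positivity
  -- The sample point must approximate `φ z` and `weightedRadial φ z` at once, so the net is taken
  -- for the pairs.
  have htb : TotallyBounded ((fun z => ((φ z : E), weightedRadial φ z)) '' {z | ‖(φ z : E)‖ ≤ δ}) :=
    (h_range.prod h_radial).totallyBounded.subset (by
      rintro _ ⟨z, hz, rfl⟩
      exact ⟨subset_closure (mem_image_of_mem _ hz), subset_closure (mem_image_of_mem _ hz)⟩)
  -- `A` bounds `‖f'‖ / ‖f‖` and `L` its Lipschitz constant on the ball of radius `δ`, while `K`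
  -- bounds the vectors. The total error `(A + L * K) θ ‖f‖` is then exactly `η ‖f‖`.
  obtain ⟨t, hts, htf, hcov⟩ := Metric.finite_approx_of_totallyBounded htb (η / (A + L * K))
    (by positivity)
  obtain ⟨T, hTs, hTf, rfl⟩ := Set.exists_subset_image_finite_and.1 ⟨t, hts, htf, rfl⟩
  refine ⟨T, hTf, fun z hz => ?_⟩
  obtain ⟨_, ⟨z', hz'T, rfl⟩, hzz'⟩ := mem_iUnion₂.1 (hcov (mem_image_of_mem _ hz))
  have hz' : ‖(φ z' : E)‖ ≤ δ := hTs hz'T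
  rw [mem_ball, Prod.dist_eq, max_lt_iff, dist_eq_norm, dist_eq_norm] at hzz'
  obtain ⟨hd1, hd2⟩ := hzz'
  refine ⟨z', hz'T, fun f => ?_⟩
  set θ := η / (A + L * K) with hθ
  have hsplit : ballDeriv f (φ z) (weightedRadial φ z) =
      ballDeriv f (φ z') (weightedRadial φ z') +
      (ballDeriv f (φ z) (weightedRadial φ z - weightedRadial φ z') +
      (ballDeriv f (φ z) - ballDeriv f (φ z')) (weightedRadial φ z')) := by
    rw [map_sub, sub_apply]
    ring
  have hb1 : ‖ballDeriv f (φ z) (weightedRadial φ z - weightedRadial φ z')‖ ≤ A * ‖f‖ * θ := by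
    refine (ContinuousLinearMap.le_opNorm _ _).trans ?_
    gcongr
    exact f.norm_ballDeriv_le hδ hz
  have hb2 : ‖(ballDeriv f (φ z) - ballDeriv f (φ z')) (weightedRadial φ z')‖ ≤
      L * ‖f‖ * θ * K := by
    refine (ContinuousLinearMap.le_opNorm _ _).trans ?_
    have h4 := f.norm_ballDeriv_sub_le hδ hz' hz
    have h5 : 3 / (1 - ((1 + δ) / 2) ^ 2) * ‖f‖ / ((1 - δ) / 2) = L * ‖f‖ := by
      rw [hL]; ring
    rw [h5] at h4
    have h6 : ‖ballDeriv f (φ z) - ballDeriv f (φ z')‖ ≤ L * ‖f‖ * θ := h4.trans (by gcongr)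
    have h7 := hK z' hz'
    gcongr
  have hsum : A * ‖f‖ * θ + L * ‖f‖ * θ * K = η * ‖f‖ := by
    rw [hθ]
    field_simp
  rw [hsplit]
  refine (norm_add_le _ _).trans ?_
  have := norm_add_le (ballDeriv f (φ z) (weightedRadial φ z - weightedRadial φ z'))
    ((ballDeriv f (φ z) - ballDeriv f (φ z')) (weightedRadial φ z'))
  linarith

theorem isBloch_of_radial {f : ball (0 : E) 1 → ℂ} (hf : IsAnalytic f) {N : ℝ}
    (hN : ∀ y : ball (0 : E) 1, (1 - ‖(y : E)‖ ^ 2) * ‖radialDeriv f y‖ ≤ N) : IsBloch f := by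
  refine ⟨hf, 48 * N, ?_⟩
  rintro _ ⟨x, rfl⟩
  linarith [one_sub_sq_mul_norm_ballDeriv_le hf x, invGradNorm_le_of_radial hf hN x]

theorem Bloch.norm_le_of_radial (f : Bloch E) {N : ℝ}
    (hN : ∀ y : ball (0 : E) 1, (1 - ‖(y : E)‖ ^ 2) * ‖radialDeriv f y‖ ≤ N) :
    ‖f‖ ≤ ‖f ballZero‖ + 16 * N :=
  norm_le_of_forall fun x => by linarith [invGradNorm_le_of_radial f.isBloch.1 hN x]

/-- A uniform bound for the pulled-back radial derivatives makes the composition operator a bounded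
operator on the Bloch space. -/
theorem exists_compositionOperator (hφ : IsAnalytic fun z => (φ z : E)) {A : ℝ}
    (hA : ∀ (f : Bloch E) z, ‖ballDeriv f (φ z) (weightedRadial φ z)‖ ≤ A * ‖f‖) :
    ∃ C : Bloch E →L[ℂ] Bloch E, ∀ (f : Bloch E) (z : ball (0 : E) 1), C f z = f (φ z) := by
  have hN : ∀ (f : Bloch E) (z : ball (0 : E) 1),
      (1 - ‖(z : E)‖ ^ 2) * ‖radialDeriv (fun z => f (φ z)) z‖ ≤ A * ‖f‖ := fun f z =>
    (one_sub_sq_mul_norm_radialDeriv_comp f.isBloch.1 hφ z).trans_le (hA f z)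
  let C₀ : Bloch E →ₗ[ℂ] Bloch E :=
    { toFun := fun f => ⟨fun z => f (φ z), isBloch_of_radial (f.isBloch.1.comp hφ) (hN f)⟩
      map_add' := fun _ _ => rfl
      map_smul' := fun _ _ => rfl }
  -- The first bracket bounds the evaluation at `φ(0)`, which is the value of `f ∘ φ` at the origin;
  -- `16 * A` bounds the invariant seminorm.
  refine ⟨C₀.mkContinuous ((1 + 3 / (1 - ‖(φ ballZero : E)‖ ^ 2)) + 16 * A) fun f => ?_,
    fun f z => rfl⟩
  have h1 := (C₀ f).norm_le_of_radial (hN f)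
  have h2 := f.norm_apply_le (mem_ball_zero_iff.1 (φ ballZero).2) le_rfl
  have h3 : (C₀ f) ballZero = f (φ ballZero) := rfl
  rw [h3] at h1
  linarith

/-- By `happrox`, sampling the functionals on a finite set determines all of them up to a small
multiple of the norm, hence determines `C f` up to `ε` once `f(φ(0))` is known as well. -/
theorem isCompactOperator_compositionOperator (hφ : IsAnalytic fun z => (φ z : E)) {A : ℝ}
    (hA : ∀ (f : Bloch E) z, ‖ballDeriv f (φ z) (weightedRadial φ z)‖ ≤ A * ‖f‖)
    (happrox : ∀ η > 0, ∃ T : Set (ball (0 : E) 1), T.Finite ∧ ∀ (f : Bloch E) (c : ℝ), 0 ≤ c →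
      (∀ z ∈ T, ‖ballDeriv f (φ z) (weightedRadial φ z)‖ ≤ c) →
      ∀ z, ‖ballDeriv f (φ z) (weightedRadial φ z)‖ ≤ c + η * ‖f‖)
    {C : Bloch E →L[ℂ] Bloch E} (hC : ∀ (f : Bloch E) (z : ball (0 : E) 1), C f z = f (φ z)) :
    IsCompactOperator C := by
  refine (isCompactOperator_iff_isCompact_closure_image_closedBall
    (C : Bloch E →ₗ[ℂ] Bloch E) one_pos).2 ?_
  -- Completeness of the Bloch space reduces compactness to total boundedness.
  refine (TotallyBounded.closure ?_).isCompact_of_isClosed isClosed_closure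
  refine totallyBounded_image_of_approx fun ε hε => ?_
  obtain ⟨T, hTf, hT⟩ := happrox (ε / 128) (by positivity)
  have : Fintype T := hTf.fintype
  have hφ0 : ‖(φ ballZero : E)‖ < 1 := mem_ball_zero_iff.1 (φ ballZero).2
  set B : ℝ := 1 + 3 / (1 - ‖(φ ballZero : E)‖ ^ 2) with hB
  have hB0 : 0 ≤ B := by
    have := one_sub_sq_pos (φ ballZero)
    positivity
  -- The extra index `none` records `f(φ(0))`, since the radial derivatives do not see constants.
  refine ⟨Option T, inferInstance, fun f o => o.elim (f (φ ballZero))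
    fun z => ballDeriv f (φ z) (weightedRadial φ z), ?_, ε / 64, by positivity, ?_⟩
  · refine isBounded_iff_forall_norm_le.2 ⟨B + |A|, ?_⟩
    rintro _ ⟨f, hf, rfl⟩
    rw [mem_closedBall_zero_iff] at hf
    refine (pi_norm_le_iff_of_nonneg (by positivity)).2 fun o => ?_
    rcases o with _ | z
    · have h1 : ‖f (φ ballZero)‖ ≤ B * ‖f‖ := f.norm_apply_le hφ0 le_rfl
      have h2 : B * ‖f‖ ≤ B := mul_le_of_le_one_right hB0 hf
      exact h1.trans (h2.trans (le_add_of_nonneg_right (abs_nonneg A)))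
    · have h1 : A * ‖f‖ ≤ |A| * 1 := by
        gcongr
        exact le_abs_self A
      exact (hA f z).trans (by linarith)
  · intro f hf g hg hfg
    rw [mem_closedBall_zero_iff] at hf hg
    -- Hence `‖C (f - g)‖ ≤ ε/64 + 16 (ε/64 + 2 * ε/128) = ε/64 + ε/2 < ε`.
    have hnorm : ‖f - g‖ ≤ 2 := (norm_sub_le f g).trans (by linarith)
    have hd := (dist_pi_lt_iff (by positivity)).1 hfg
    have h0 : ‖(f - g) (φ ballZero)‖ ≤ ε / 64 := by
      have := (hd none).le
      rwa [dist_eq_norm] at this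
    have h1 := hT (f - g) (ε / 64) (by positivity) fun z hz => by
      have := (hd (some ⟨z, hz⟩)).le
      rw [dist_eq_norm] at this
      rwa [Bloch.coe_sub, ballDeriv_sub f.isBloch.1 g.isBloch.1]
    have h2 := (C (f - g)).norm_le_of_radial (N := ε / 64 + ε / 128 * ‖f - g‖) fun z => by
      have h3 : ⇑(C (f - g)) = fun z => (f - g) (φ z) := funext (hC (f - g))
      rw [h3, one_sub_sq_mul_norm_radialDeriv_comp (f - g).isBloch.1 hφ]
      exact h1 z
    rw [hC] at h2
    change dist (C f) (C g) < ε
    rw [dist_eq_norm, ← map_sub]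
    nlinarith

end Composition

end BlochBall

theorem mainTheorem1 {E : Type*} [NormedAddCommGroup E] [InnerProductSpace ℂ E] [CompleteSpace E]
    (φ : ball (0 : E) 1 → ball (0 : E) 1)
    (hφ : BlochBall.IsAnalytic (fun z => (φ z : E)))
    (h_range : ∀ δ : ℝ, 0 < δ → δ < 1 →
      IsCompact (closure ((fun z => (φ z : E)) '' {z | ‖(φ z : E)‖ ≤ δ})))
    (h_radial : ∀ δ : ℝ, 0 < δ → δ < 1 →
      IsCompact (closure
        ((fun z : ball (0 : E) 1 =>
            (1 - ‖(z : E)‖ ^ 2) • BlochBall.radialDeriv (fun z => (φ z : E)) z) ''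
          {z | ‖(φ z : E)‖ ≤ δ})))
    (h_lim_norm : Tendsto
      (fun z : ball (0 : E) 1 =>
        (1 - ‖(z : E)‖ ^ 2) * ‖BlochBall.radialDeriv (fun z => (φ z : E)) z‖ /
          √(1 - ‖(φ z : E)‖ ^ 2))
      (comap (fun z => ‖(φ z : E)‖) (𝓝 1)) (𝓝 0))
    (h_lim_inner : Tendsto
      (fun z : ball (0 : E) 1 =>
        (1 - ‖(z : E)‖ ^ 2) *
            ‖(inner ℂ (φ z : E) (BlochBall.radialDeriv (fun z => (φ z : E)) z) : ℂ)‖ /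
          (1 - ‖(φ z : E)‖ ^ 2))
      (comap (fun z => ‖(φ z : E)‖) (𝓝 1)) (𝓝 0)) :
    ∃ C : BlochBall.Bloch E →L[ℂ] BlochBall.Bloch E,
      (∀ (f : BlochBall.Bloch E) (z : ball (0 : E) 1), C f z = f (φ z)) ∧
        IsCompactOperator C := by
  simp only [← BlochBall.norm_weightedRadial] at h_lim_norm
  simp only [← BlochBall.norm_inner_weightedRadial] at h_lim_inner
  have h_radial' : ∀ δ : ℝ, 0 < δ → δ < 1 →
    IsCompact (closure (BlochBall.weightedRadial φ '' {z | ‖(φ z : E)‖ ≤ δ})) := h_radial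
  -- Boundedness needs only the single value `η = 1` near the sphere; elsewhere `‖f'(φ(z))‖` and
  -- `w(z)` are both bounded.
  have hA : ∃ A : ℝ, ∀ (f : BlochBall.Bloch E) z,
      ‖BlochBall.ballDeriv f (φ z) (BlochBall.weightedRadial φ z)‖ ≤ A * ‖f‖ := by
    obtain ⟨δ, hδ0, hδ1, hδ⟩ :=
      BlochBall.exists_norm_apply_weightedRadial_le h_lim_norm h_lim_inner one_pos
    obtain ⟨K, hK0, hK⟩ := BlochBall.isBounded_weightedRadial (h_radial' δ hδ0 hδ1)
    have h1 : 0 < 1 - δ ^ 2 := by nlinarith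
    refine ⟨1 + 3 / (1 - δ ^ 2) * K, fun f z => ?_⟩
    rcases lt_or_ge δ ‖(φ z : E)‖ with hz | hz
    · refine (hδ f z hz).trans ?_
      gcongr
      exact le_add_of_nonneg_right (by positivity)
    · calc _ ≤ _ := ContinuousLinearMap.le_opNorm _ _
        _ ≤ 3 / (1 - δ ^ 2) * ‖f‖ * K :=
          mul_le_mul (f.norm_ballDeriv_le hδ1 hz) (hK z hz) (norm_nonneg _) (by positivity)
        _ ≤ _ := by nlinarith [norm_nonneg f]
  obtain ⟨A, hA⟩ := hA
  obtain ⟨C, hC⟩ := BlochBall.exists_compositionOperator hφ hA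
  refine ⟨C, hC, BlochBall.isCompactOperator_compositionOperator hφ hA (fun η hη => ?_) hC⟩
  obtain ⟨δ, hδ0, hδ1, hδ⟩ :=
    BlochBall.exists_norm_apply_weightedRadial_le h_lim_norm h_lim_inner hη
  obtain ⟨T, hTf, hT⟩ := BlochBall.exists_finite_approx hδ1 (h_range δ hδ0 hδ1)
    (h_radial' δ hδ0 hδ1) hη
  refine ⟨T, hTf, fun f c hc0 hc z => ?_⟩
  -- Near the sphere the functional is already below `η * ‖f‖` without any sample; elsewhere it is
  -- compared with a sample point of `T`.
  rcases lt_or_ge δ ‖(φ z : E)‖ with hz | hz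
  · linarith [hδ f z hz]
  · obtain ⟨z', hz', h⟩ := hT z hz
    linarith [h f, hc z' hz']
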